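/- A Schur partition is a partition in which any two parts differ by at least $3$ and no two consecutive multiples of $3$ both occur (the empty partition is allowed). Pairs. In a Schur partition $\pi$, a part $x$ belongs to an upper pair if $x+3$ or $x-3$ is also a part, with two exceptions: $x$ is odd and is the largest term of a maximal arithmetic progression of parts of common difference $3$ and odd length; or $x$ is even and is the smallest term of such a progression. A part $x>1$ belongs to a lower pair if $x+3$ or $x-3$ is also a part, with two exceptions: $x$ is even and is the largest term of a maximal odd-length progression, of common difference $3$, of parts greater than $1$; or $x$ is odd and is the smallest term of such a progression. Parts that are not in an upper pair are called upper singletons. Upper minimal segments. Let $\mathcal U$ be the smallest set of Schur partitions that contains, for every odd $o>3$, (1) $\{o,o+4,\dots,o+4x,\;o+4x+5,o+4x+9,\dots,o+4(x+y)+5\}$ for $x,y\ge 0$; (2) $\{o,o+4,\dots,o+4x,\;p^*+3,p^*+6,\dots,p^*+3p,\;p^*+3p+4,\dots,p^*+3p+4y\}$, where $p^*=o+4x+1\not\equiv 0\pmod 3$, $x\ge 0$, $y>0$, and $p>0$ is even; and is closed under: (suffix rule) if $\Sigma\in\mathcal U$ has even largest part $e\not\equiv0\pmod 3$, then $\Sigma\cup\{e+3,e+6,\dots,e+3p,\;e+3p+4,\dots,e+3p+4y\}\in\mathcal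 U$ for all $y>0$ and all even $p>0$; (prefix rule) if $\Sigma\in\mathcal U$ has smallest part $o'+4k+3(p+1)+1\not\equiv0\pmod 3$ with $o'>3$ odd, $k\ge0$ and $p>0$ even, then $\{o',o'+4,\dots,o'+4k,\;o'+4k+4,o'+4k+7,\dots,o'+4k+3p+1\}\cup\Sigma\in\mathcal U$. An upper minimal segment of $\pi$ is a subset $\Sigma$ of the parts of $\pi$ such that $\Sigma\in\mathcal U$ and the smallest and the largest part of $\Sigma$ are upper singletons of $\pi$. It is longest if it is not properly contained in another upper minimal segment of $\pi$. The map $\rho$. Let $\Sigma\in\mathcal U$ have $\omega'$ odd and $\epsilon'$ even upper singletons. If $\omega'=\epsilon'$, then $\rho$ lowers every part of $\Sigma$ by $3$. If $\omega'>\epsilon'$, it lowers the largest $\omega'-\epsilon'$ odd singletons by $2$ and every other part by $3$. If $\omega'<\epsilon'$, it lowers the smallest $\epsilon'-\omega'$ even singletons by $4$ and every other part by $3$. The map $\psi$. For a Schur partition $\pi$ whose odd parts are all $\ge 3$ and whose even parts are all $\ge 6$, $\psi(\pi)$ is obtained by applying $\rho$ to each longest upper minimal segment of $\pi$, and, among the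 parts that lie in no upper minimal segment, lowering each part of an upper pair by $3$, each even upper singleton by $4$ and each odd upper singleton by $2$. Theorem 3 (The Schur reduction map). Let $\mathcal D^*(\omega,\epsilon,p_1,p_2,n)$ be the set of Schur partitions of $n$ whose odd parts are all $\ge3$ and whose even parts are all $\ge6$, with $\omega$ odd parts, $\epsilon$ even parts, $p_1$ parts $\equiv1\pmod3$ that belong to an upper pair, and $p_2$ parts $\equiv2\pmod 3$ that belong to an upper pair. Let $\mathcal D(\omega,\epsilon,p_1,p_2,n)$ be the set of Schur partitions of $n$ with $\omega$ odd parts, $\epsilon$ even parts, $p_1$ parts $\equiv1\pmod3$ that belong to a lower pair, and $p_2$ parts $\equiv2\pmod3$ that belong to a lower pair. Then $\psi$ is a bijection $$\psi:\mathcal D^*(\omega,\epsilon,p_1,p_2,n)\to\mathcal D(\omega,\epsilon,p_1,p_2,n-2(\omega+2\epsilon)).$$ Consequently, if $\mathcal D(m,n)$ denotes the set of Schur partitions of $n$ for which the number of parts plus the number of even parts is $m$, and $\mathcal D^*(m,n)$ the subset of those whose odd parts are all $\ge3$ and whose even parts are all $\ge6$, then $\psi$ is also a bijection $\mathcal D^*(m,n)\to\mathcal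 D(m,n-2m)$. -/

import Mathlib

namespace SchurReduction

/-- A Schur partition: parts differ by at least `3`, and no two consecutive multiples of `3` both
occur. The parts of such a partition are distinct, so it is given by the finite set of its parts;
`∅` is the partition of `0`. -/
def IsSchur (π : Finset ℕ) : Prop :=
  (∀ x ∈ π, 0 < x) ∧
    ∀ x ∈ π, ∀ y ∈ π, x < y → x + 3 ≤ y ∧ ¬ (3 ∣ x ∧ y = x + 3)

/-- Every odd part is at least `3` and every even part is at least `6`. -/
def IsStar (π : Finset ℕ) : Prop :=
  ∀ x ∈ π, (Odd x → 3 ≤ x) ∧ (Even x → 6 ≤ x)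

/-- `a, a + 3, …, a + 3 (l - 1)` is a maximal arithmetic progression of difference `3` (of length
`l ≥ 1`) among the members of `A`. -/
def IsMaxRun (A : Finset ℕ) (a l : ℕ) : Prop :=
  0 < l ∧ (∀ i < l, a + 3 * i ∈ A) ∧ (∀ b ∈ A, b + 3 ≠ a) ∧ a + 3 * l ∉ A

/-- `x` is the smallest member of a maximal progression of odd length. -/
def IsOddRunMin (A : Finset ℕ) (x : ℕ) : Prop :=
  ∃ l, Odd l ∧ IsMaxRun A x l

/-- `x` is the largest member of a maximal progression of odd length. -/
def IsOddRunMax (A : Finset ℕ) (x : ℕ) : Prop :=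
  ∃ a l, Odd l ∧ IsMaxRun A a l ∧ x + 3 = a + 3 * l

/-- `x` is part of an upper pair of `π`. -/
def UpperPaired (π : Finset ℕ) (x : ℕ) : Prop :=
  x ∈ π ∧ (x + 3 ∈ π ∨ ∃ y ∈ π, y + 3 = x) ∧
    ¬ (Odd x ∧ IsOddRunMax π x) ∧ ¬ (Even x ∧ IsOddRunMin π x)

/-- `x` is part of a lower pair of `π`; maximal progressions are taken among the parts `> 1`. -/
def LowerPaired (π : Finset ℕ) (x : ℕ) : Prop :=
  x ∈ π ∧ 1 < x ∧ (x + 3 ∈ π ∨ ∃ y ∈ π, y + 3 = x) ∧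
    ¬ (Even x ∧ IsOddRunMax (π.filter (1 < ·)) x) ∧
    ¬ (Odd x ∧ IsOddRunMin (π.filter (1 < ·)) x)

/-- The arithmetic progression `a, a + d, …, a + d (l - 1)`. -/
def progression (a d l : ℕ) : Finset ℕ :=
  (Finset.range l).image fun i => a + d * i

/-- The set `𝒰` of (abstract) upper minimal segments: the smallest family that contains the two
primitive forms and is closed under the suffix rule and the prefix rule. -/
inductive UpperMinimal : Finset ℕ → Prop
  | primitive_one (o x y : ℕ) (ho : Odd o) (ho3 : 3 < o) :
      UpperMinimal (progression o 4 (x + 1) ∪ progression (o + 4 * x + 5) 4 (y + 1))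
  | primitive_two (o x p y : ℕ) (ho : Odd o) (ho3 : 3 < o) (h3 : ¬ 3 ∣ o + 4 * x + 1)
      (hp : 0 < p) (hpe : Even p) (hy : 0 < y) :
      UpperMinimal (progression o 4 (x + 1) ∪ progression (o + 4 * x + 1 + 3) 3 p ∪
        progression (o + 4 * x + 1 + 3 * p + 4) 4 y)
  | suffix (S : Finset ℕ) (e p y : ℕ) (hS : UpperMinimal S) (hmax : IsGreatest (S : Set ℕ) e)
      (he : Even e) (h3 : ¬ 3 ∣ e) (hp : 0 < p) (hpe : Even p) (hy : 0 < y) :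
      UpperMinimal (S ∪ progression (e + 3) 3 p ∪ progression (e + 3 * p + 4) 4 y)
  | prefix (S : Finset ℕ) (o k p : ℕ) (hS : UpperMinimal S)
      (hmin : IsLeast (S : Set ℕ) (o + 4 * k + 3 * (p + 1) + 1))
      (h3 : ¬ 3 ∣ o + 4 * k + 3 * (p + 1) + 1) (ho : Odd o) (ho3 : 3 < o)
      (hp : 0 < p) (hpe : Even p) :
      UpperMinimal (progression o 4 (k + 1) ∪ progression (o + 4 * k + 3 + 1) 3 p ∪ S)

/-- `S` is an upper minimal segment of `π`: a subpartition in `𝒰` whose endpoints are upper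
singletons of `π`. -/
def IsUpperSegment (π S : Finset ℕ) : Prop :=
  S ⊆ π ∧ UpperMinimal S ∧
    ∀ x, IsLeast (S : Set ℕ) x ∨ IsGreatest (S : Set ℕ) x → ¬ UpperPaired π x

/-- `S` is a longest upper minimal segment of `π`: one that is not properly contained in another
upper minimal segment of `π`. -/
def IsLongestUpperSegment (π S : Finset ℕ) : Prop :=
  IsUpperSegment π S ∧ ∀ T, IsUpperSegment π T → ¬ S ⊂ T

open Classical in
/-- The odd upper singletons of `S`. -/
noncomputable def oddSingletons (S : Finset ℕ) : Finset ℕ :=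
  S.filter fun x => Odd x ∧ ¬ UpperPaired S x

open Classical in
/-- The even upper singletons of `S`. -/
noncomputable def evenSingletons (S : Finset ℕ) : Finset ℕ :=
  S.filter fun x => Even x ∧ ¬ UpperPaired S x

open Classical in
/-- The effect of `ρ` on a part `x` of the segment `S` with `ω'` odd and `ε'` even singletons:
the largest `ω' - ε'` odd singletons are lowered by `2`, the smallest `ε' - ω'` even singletons
are lowered by `4` (none if the truncated difference is `0`), every other part by `3`. -/
noncomputable def rhoPart (S : Finset ℕ) (x : ℕ) : ℕ :=
  if x ∈ oddSingletons S ∧ ((oddSingletons S).filter (x < ·)).card <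
      (oddSingletons S).card - (evenSingletons S).card then x - 2
  else if x ∈ evenSingletons S ∧ ((evenSingletons S).filter (· < x)).card <
      (evenSingletons S).card - (oddSingletons S).card then x - 4
  else x - 3

/-- The reduction map `ρ` on upper minimal segments. -/
noncomputable def rho (S : Finset ℕ) : Finset ℕ :=
  S.image (rhoPart S)

open Classical in
/-- The longest upper minimal segments of `π`. -/
noncomputable def longestSegments (π : Finset ℕ) : Finset (Finset ℕ) :=
  π.powerset.filter (IsLongestUpperSegment π)

/-- The parts of `π` that lie in no upper minimal segment. -/
noncomputable def freeParts (π : Finset ℕ) : Finset ℕ :=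
  π \ (longestSegments π).biUnion id

open Classical in
/-- The effect of the Schur reduction map on a part outside the upper minimal segments. -/
noncomputable def freeReduce (π : Finset ℕ) (x : ℕ) : ℕ :=
  if UpperPaired π x then x - 3 else if Even x then x - 4 else x - 2

/-- The Schur reduction map `ψ`. -/
noncomputable def psi (π : Finset ℕ) : Finset ℕ :=
  (longestSegments π).biUnion rho ∪ (freeParts π).image (freeReduce π)

/-- The sum of the parts. -/
def size (π : Finset ℕ) : ℕ := ∑ x ∈ π, x

/-- The number of odd parts. -/
def numOdd (π : Finset ℕ) : ℕ := (π.filter fun x => Odd x).card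

/-- The number of even parts. -/
def numEven (π : Finset ℕ) : ℕ := (π.filter fun x => Even x).card

open Classical in
/-- The number of parts that belong to an upper pair and are congruent to `r` modulo `3`. -/
noncomputable def numUpperPaired (r : ℕ) (π : Finset ℕ) : ℕ :=
  (π.filter fun x => UpperPaired π x ∧ x ≡ r [MOD 3]).card

open Classical in
/-- The number of parts that belong to a lower pair and are congruent to `r` modulo `3`. -/
noncomputable def numLowerPaired (r : ℕ) (π : Finset ℕ) : ℕ :=
  (π.filter fun x => LowerPaired π x ∧ x ≡ r [MOD 3]).card

/-- `m(π)`: the number of parts plus the number of even parts. -/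
def weight (π : Finset ℕ) : ℕ := π.card + numEven π

/-- `𝒟*(ω, ε, p₁, p₂, n)`. -/
def refinedDStar (ω ε p₁ p₂ : ℕ) (n : ℤ) : Set (Finset ℕ) :=
  {π | IsSchur π ∧ IsStar π ∧ (size π : ℤ) = n ∧ numOdd π = ω ∧ numEven π = ε ∧
    numUpperPaired 1 π = p₁ ∧ numUpperPaired 2 π = p₂}

/-- `𝒟(ω, ε, p₁, p₂, n)`. -/
def refinedD (ω ε p₁ p₂ : ℕ) (n : ℤ) : Set (Finset ℕ) :=
  {π | IsSchur π ∧ (size π : ℤ) = n ∧ numOdd π = ω ∧ numEven π = ε ∧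
    numLowerPaired 1 π = p₁ ∧ numLowerPaired 2 π = p₂}

/-- `𝒟*(m, n)`. -/
def DStar (m : ℕ) (n : ℤ) : Set (Finset ℕ) :=
  {π | IsSchur π ∧ IsStar π ∧ (size π : ℤ) = n ∧ weight π = m}

/-- `𝒟(m, n)`. -/
def D (m : ℕ) (n : ℤ) : Set (Finset ℕ) :=
  {π | IsSchur π ∧ (size π : ℤ) = n ∧ weight π = m}

end SchurReduction

namespace SchurReduction

/-! ### Maximal progressions of difference `3` -/

/-! The map `psi` is an involution on Schur partitions with parts at least 3, followed by lowering
every part by 3.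

Such a partition is encoded by a triple `(P, K, E)`: `P` consists of the paired parts, `K` records
for each singleton the odd number `k` for which the singleton is `k` or `k + 1`, and `E` is the set
of those `k` for which it is `k + 1`. The point of this encoding is that the distance conditions on
`P` and `K` do not mention `E`. The only constraint on the signs is that they increase along links:
if `j` and `k` are linked and the singleton at `j` is even, so is the one at `k`; otherwise the two
would close up with the paired parts between them to a run of even length and be paired themselves.
`isSigned_of_isSchur` and `realize_paired` give the encoding and its inverse;
`IsSigned.upperPaired_iff` shows that every admissible triple is recovered from its partition.

Links cut `K` into clusters. On each cluster `E` is an upper set, hence determined by its size, and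
`flip` replaces it by the upper set of complementary size. This is an involution that keeps `P` and
`K`; on partitions it is `exchange`.

To identify `psi` with `exchange` followed by the shift (`psi_eq`), the longest upper minimal
segments are shown to be the stretches spanned by the clusters with both signs. There `rho` is the
flip, read off from ranks; in a cluster with one sign the flip reverses every sign, which after the
shift lowers odd singletons by 2 and even ones by 4.

The number 3 needs care. No link starts at key 3, so `exchange` simply swaps the parts 3 and 4.
Partitions without 4 therefore go to partitions without 3, and the shift makes these all Schur
partitions. A part 4 of the exchanged partition becomes 1, which lower pairs disregard; for this
reason 4 is erased before pairs are formed. The statistics follow because runs of paired parts have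
even length, so half of `P` is odd, while the flip and the shift each reverse the parity count of
singletons. -/

theorem IsMaxRun.mem {A : Finset ℕ} {a l i : ℕ} (h : IsMaxRun A a l) (hi : i < l) :
    a + 3 * i ∈ A := h.2.1 i hi

theorem exists_forall_lt_mem (A : Finset ℕ) (a : ℕ) :
    ∃ l, (∀ i < l, a + 3 * i ∈ A) ∧ a + 3 * l ∉ A := by
  classical
  have hex : ∃ l, a + 3 * l ∉ A := by
    refine ⟨A.sup id + 1, fun h => ?_⟩
    have := Finset.le_sup (f := id) h
    simp only [id] at this
    omega
  refine ⟨Nat.find hex, fun i hi => ?_, Nat.find_spec hex⟩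
  have := Nat.find_min hex hi
  simpa using this

theorem exists_run_start {A : Finset ℕ} {x : ℕ} (hx : x ∈ A) :
    ∃ a i, x = a + 3 * i ∧ (∀ j ≤ i, a + 3 * j ∈ A) ∧ ∀ b ∈ A, b + 3 ≠ a := by
  induction x using Nat.strong_induction_on with
  | _ x ih =>
    by_cases h : ∃ b ∈ A, b + 3 = x
    · obtain ⟨b, hb, rfl⟩ := h
      obtain ⟨a, i, rfl, hi, ha⟩ := ih b (by omega) hb
      refine ⟨a, i + 1, by ring, fun j hj => ?_, ha⟩
      rcases Nat.lt_or_ge i j with h | h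
      · obtain rfl : j = i + 1 := by omega
        exact hx
      · exact hi j h
    · push Not at h
      exact ⟨x, 0, by simp, fun j hj => by obtain rfl : j = 0 := by omega
                                           simpa using hx, h⟩

theorem exists_isMaxRun {A : Finset ℕ} {x : ℕ} (hx : x ∈ A) :
    ∃ a l i, IsMaxRun A a l ∧ i < l ∧ x = a + 3 * i := by
  obtain ⟨a, i, rfl, hi, ha⟩ := exists_run_start hx
  obtain ⟨l, hl, hl'⟩ := exists_forall_lt_mem A a
  have hil : i < l := by
    by_contra h
    exact hl' (hi l (by omega))
  exact ⟨a, l, i, ⟨by omega, hl, ha, hl'⟩, hil, rfl⟩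

theorem IsMaxRun.start_le {A : Finset ℕ} {a l i b m j : ℕ} (h : IsMaxRun A a l)
    (h' : IsMaxRun A b m) (hj : j < m) (e : a + 3 * i = b + 3 * j) : a ≤ b := by
  by_contra hlt
  obtain ⟨d, hd⟩ : ∃ d, a = b + 3 * (d + 1) := ⟨j - i - 1, by omega⟩
  exact h.2.2.1 (b + 3 * d) (h'.mem (by omega)) (by omega)

theorem IsMaxRun.unique {A : Finset ℕ} {a l i b m j : ℕ} (h : IsMaxRun A a l)
    (h' : IsMaxRun A b m) (hi : i < l) (hj : j < m) (e : a + 3 * i = b + 3 * j) :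
    a = b ∧ l = m := by
  have hab : a = b := le_antisymm (h.start_le h' hj e) (h'.start_le h hi e.symm)
  subst hab
  refine ⟨rfl, ?_⟩
  by_contra hne
  rcases Nat.lt_or_gt_of_ne hne with hlt | hlt
  · exact h.2.2.2 (h'.mem hlt)
  · exact h'.2.2.2 (h.mem hlt)

/-- In a run of odd length both ends have the parity of `a`, so exactly one end is left unpaired:
the last if `a` is odd, the first if `a` is even. -/
theorem upperPaired_iff {A : Finset ℕ} {a l i : ℕ} (h : IsMaxRun A a l) (hi : i < l) :
    UpperPaired A (a + 3 * i) ↔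
      1 < l ∧ ¬ (Odd l ∧ Odd a ∧ i + 1 = l) ∧ ¬ (Odd l ∧ Even a ∧ i = 0) := by
  have hmem := h.mem hi
  have hnb : (a + 3 * i + 3 ∈ A ∨ ∃ y ∈ A, y + 3 = a + 3 * i) ↔ 1 < l := by
    constructor
    · rintro (h1 | ⟨y, hy, hy'⟩)
      · by_contra hl
        obtain rfl : l = 1 := by omega
        obtain rfl : i = 0 := by omega
        exact h.2.2.2 (by simpa using h1)
      · by_contra hl
        obtain rfl : i = 0 := by omega
        exact h.2.2.1 y hy (by simpa using hy')
    · intro hl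
      rcases Nat.eq_zero_or_pos i with rfl | hi0
      · left
        have := h.mem (i := 1) hl
        simpa using this
      · right
        exact ⟨a + 3 * (i - 1), h.mem (by omega), by omega⟩
  have hmax : IsOddRunMax A (a + 3 * i) ↔ Odd l ∧ i + 1 = l := by
    constructor
    · rintro ⟨b, m, hm, hb, e⟩
      have := h.unique hb hi (j := m - 1) (by have := hb.1; omega) (by have := hb.1; omega)
      obtain ⟨rfl, rfl⟩ := this
      exact ⟨hm, by omega⟩
    · rintro ⟨hl, e⟩
      exact ⟨a, l, hl, h, by omega⟩
  have hmin : IsOddRunMin A (a + 3 * i) ↔ Odd l ∧ i = 0 := by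
    constructor
    · rintro ⟨m, hm, hb⟩
      have := h.unique hb hi (j := 0) hb.1 (by omega)
      obtain ⟨e, rfl⟩ := this
      exact ⟨hm, by omega⟩
    · rintro ⟨hl, rfl⟩
      exact ⟨l, hl, by simpa using h⟩
  rw [UpperPaired, hnb, hmax, hmin]
  simp only [hmem, true_and]
  refine and_congr_right fun _ => and_congr (not_congr ?_) (not_congr ?_)
  · constructor
    · rintro ⟨h1, h2, h3⟩
      exact ⟨h2, by grind, h3⟩
    · rintro ⟨h1, h2, h3⟩
      exact ⟨by grind, h1, h3⟩
  · constructor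
    · rintro ⟨h1, h2, h3⟩
      exact ⟨h2, by subst h3; simpa using h1, h3⟩
    · rintro ⟨h1, h2, h3⟩
      exact ⟨by subst h3; simpa using h2, h1, h3⟩

/-- An odd member followed at distance `3` is paired. -/
theorem upperPaired_of_odd_of_add {A : Finset ℕ} {x : ℕ} (hx : x ∈ A) (ho : Odd x)
    (h : x + 3 ∈ A) : UpperPaired A x := by
  refine ⟨hx, Or.inl h, ?_, fun h' => ?_⟩
  · rintro ⟨-, a, l, -, hr, e⟩
    exact hr.2.2.2 (e ▸ h)
  · exact (Nat.not_even_iff_odd.2 ho) h'.1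

/-- An even member preceded at distance `3` is paired. -/
theorem upperPaired_of_even_of_sub {A : Finset ℕ} {x : ℕ} (hx : x + 3 ∈ A) (ho : Even (x + 3))
    (h : x ∈ A) : UpperPaired A (x + 3) := by
  refine ⟨hx, Or.inr ⟨x, h, rfl⟩, fun h' => ?_, ?_⟩
  · exact (Nat.not_even_iff_odd.2 h'.1) ho
  · rintro ⟨-, l, -, hr⟩
    exact hr.2.2.1 x h rfl

/-- The two smallest members of the lowest run have opposite parity; deleting them leaves all run
lengths even. -/
theorem card_odd_eq_card_even {P : Finset ℕ} (h : ∀ a l, IsMaxRun P a l → Even l) :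
    (P.filter fun x => Odd x).card = (P.filter fun x => Even x).card := by
  induction hn : P.card using Nat.strong_induction_on generalizing P with
  | _ n ih =>
    rcases P.eq_empty_or_nonempty with rfl | hne
    · simp
    set a := P.min' hne with ha
    have haP : a ∈ P := P.min'_mem hne
    have hmin : ∀ b ∈ P, a ≤ b := fun b hb => P.min'_le b hb
    obtain ⟨l, hl, hl'⟩ := exists_forall_lt_mem P a
    have hl0 : 0 < l := by
      rcases Nat.eq_zero_or_pos l with rfl | h
      · exact absurd haP (by simpa using hl')
      · exact h
    have hrun : IsMaxRun P a l := ⟨hl0, hl, fun b hb => by have := hmin b hb; omega, hl'⟩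
    have hle := h a l hrun
    have ha3 : a + 3 ∈ P := by simpa using hl 1 (by rcases hle with ⟨r, rfl⟩; omega)
    have key : ∀ b m, IsMaxRun ((P.erase a).erase (a + 3)) b m → Even m := by
      intro b m hb
      have hbm := hb.mem hb.1
      simp only [Finset.mem_erase, mul_zero, add_zero, ne_eq] at hbm
      have hb0 := hmin b hbm.2.2
      have hend : b + 3 * m ∉ P := fun hc => hb.2.2.2 (by
        simp only [Finset.mem_erase, ne_eq]
        exact ⟨by have := hb.1; omega, by omega, hc⟩)
      -- A run starting at `a + 6` is what remains of the lowest run, shortened by two; any other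
      -- run is untouched.
      by_cases hb6 : b = a + 6
      · have : IsMaxRun P a (m + 2) := by
          refine ⟨by omega, fun i hi => ?_, hrun.2.2.1, by
            rw [hb6] at hend
            rwa [show a + 3 * (m + 2) = a + 6 + 3 * m by ring]⟩
          match i, hi with
          | 0, _ => simpa using haP
          | 1, _ => simpa using ha3
          | i + 2, hi =>
            have := hb.mem (i := i) (by omega)
            simp only [Finset.mem_erase] at this
            rw [hb6] at this
            convert this.2.2 using 1
            ring
        have := h a _ this
        grind
      · refine h b m ⟨hb.1, fun i hi => ?_, fun c hc hc' => ?_, hend⟩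
        · have := hb.mem hi
          simp only [Finset.mem_erase] at this
          exact this.2.2
        · refine hb.2.2.1 c ?_ hc'
          simp only [Finset.mem_erase, ne_eq]
          exact ⟨by omega, by omega, hc⟩
    have hcard : ((P.erase a).erase (a + 3)).card < n := by
      rw [← hn]
      exact lt_of_le_of_lt (Finset.card_le_card (Finset.erase_subset _ _))
        (Finset.card_erase_lt_of_mem haP)
    have := ih _ hcard key rfl
    have hP : P = insert a (insert (a + 3) ((P.erase a).erase (a + 3))) := by
      rw [Finset.insert_erase (by simp [ha3]), Finset.insert_erase haP]
    rw [hP, Finset.filter_insert, Finset.filter_insert, Finset.filter_insert, Finset.filter_insert]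
    rcases Nat.even_or_odd a with hpar | hpar
    · have h3 : Odd (a + 3) := by grind
      simp only [hpar, h3, Nat.not_odd_iff_even.2 hpar, Nat.not_even_iff_odd.2 h3, if_true,
        if_false]
      rw [Finset.card_insert_of_notMem (by simp), Finset.card_insert_of_notMem (by simp), this]
    · have h3 : Even (a + 3) := by grind
      simp only [hpar, h3, Nat.not_odd_iff_even.2 h3, Nat.not_even_iff_odd.2 hpar, if_true,
        if_false]
      rw [Finset.card_insert_of_notMem (by simp), Finset.card_insert_of_notMem (by simp), this]

/-! ### Configurations of pairs and singletons -/

/-- The odd number `k` such that `x` is `k` or `k + 1`. -/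
def key (x : ℕ) : ℕ := if Even x then x - 1 else x

/-- The compatibility conditions between a set `P` of paired parts and a set `K` of keys of
singletons. -/
structure IsConfig (P K : Finset ℕ) : Prop where
  five_le : ∀ q ∈ P, 5 ≤ q
  schur : IsSchur P
  not_dvd : ∀ q ∈ P, ¬ 3 ∣ q
  even_run : ∀ a l, IsMaxRun P a l → Even l
  key_odd : ∀ k ∈ K, Odd k
  three_le : ∀ k ∈ K, 3 ≤ k
  gap : ∀ j ∈ K, ∀ k ∈ K, j < k → j + 4 ≤ k
  sep : ∀ q ∈ P, ∀ k ∈ K, k + 4 ≤ q ∨ q + 3 ≤ k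

/-- The key `j` is linked to the key `k`: between the two there is just enough room for an even
number of paired parts. -/
def Link (P : Finset ℕ) (j k : ℕ) : Prop :=
  3 < j ∧ ∃ p, Even p ∧ (∀ i < p, j + 4 + 3 * i ∈ P) ∧ k = j + 4 + 3 * p

/-- A configuration together with the set `E` of the keys of even singletons. -/
structure IsSigned (P K E : Finset ℕ) : Prop extends IsConfig P K where
  subset : E ⊆ K
  mono : ∀ j ∈ E, ∀ k ∈ K, Link P j k → k ∈ E

/-- The part with key `k`. -/
def place (E : Finset ℕ) (k : ℕ) : ℕ := if k ∈ E then k + 1 else k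

/-- The partition with given paired parts, keys and keys of even singletons. -/
def realize (P K E : Finset ℕ) : Finset ℕ := P ∪ K.image (place E)

theorem place_of_mem {E : Finset ℕ} {k : ℕ} (h : k ∈ E) : place E k = k + 1 := if_pos h

theorem place_of_notMem {E : Finset ℕ} {k : ℕ} (h : k ∉ E) : place E k = k := if_neg h

theorem key_of_even {x : ℕ} (h : Even x) : key x = x - 1 := if_pos h

theorem key_of_odd {x : ℕ} (h : Odd x) : key x = x := if_neg (Nat.not_even_iff_odd.2 h)

theorem odd_key {x : ℕ} (h : 0 < x) : Odd (key x) := by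
  rcases Nat.even_or_odd x with h' | h'
  · rw [key_of_even h']; grind
  · rwa [key_of_odd h']

theorem key_le (x : ℕ) : key x ≤ x := by unfold key; split_ifs <;> omega

theorem le_key (x : ℕ) : x ≤ key x + 1 := by unfold key; split_ifs <;> omega

theorem key_place {E : Finset ℕ} {k : ℕ} (h : Odd k) : key (place E k) = k := by
  unfold place
  split_ifs
  · rw [key_of_even (by grind)]; omega
  · exact key_of_odd h

theorem even_place {E : Finset ℕ} {k : ℕ} (h : Odd k) : Even (place E k) ↔ k ∈ E := by
  unfold place
  split_ifs with h'
  · simp only [h', iff_true]; grind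
  · simp [h', h]

theorem mem_realize {P K E : Finset ℕ} {x : ℕ} :
    x ∈ realize P K E ↔ x ∈ P ∨ ∃ k ∈ K, place E k = x := by simp [realize]

theorem le_place (E : Finset ℕ) (k : ℕ) : k ≤ place E k := by unfold place; split_ifs <;> omega

theorem place_le (E : Finset ℕ) (k : ℕ) : place E k ≤ k + 1 := by
  unfold place; split_ifs <;> omega

namespace IsConfig

variable {P K : Finset ℕ}

theorem place_notMem (h : IsConfig P K) {k : ℕ} (hk : k ∈ K) (E : Finset ℕ) : place E k ∉ P := by
  intro hP
  have := h.sep _ hP k hk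
  have := le_place E k
  have := place_le E k
  omega

/-- There is no key strictly between two linked keys. -/
theorem le_of_link (h : IsConfig P K) {j k k' : ℕ} (hj : j ∈ K) (hl : Link P j k) (hk' : k' ∈ K)
    (hlt : j < k') : k ≤ k' := by
  obtain ⟨-, p, -, hp, rfl⟩ := hl
  -- Since `k'` is not below a paired part of the run, separation puts it at least 3 above; so it
  -- clears the whole run.
  have key : ∀ i ≤ p, j + 4 + 3 * i ≤ k' := by
    intro i
    induction i with
    | zero => intro _; simpa using h.gap j hj k' hk' hlt
    | succ i ih =>
      intro hi
      have h1 := ih (by omega)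
      have h2 := h.sep _ (hp i (by omega)) k' hk'
      omega
  exact key p le_rfl

end IsConfig

/-- Distances are at least 3 whatever the signs. Two singletons are at distance exactly 3 only as `j
+ 1` and `j + 4`, even below odd, with keys 4 apart. If they are multiples of 3, then `j ≠ 3`, the
keys are linked with no paired part between, and monotonicity of signs excludes this. -/
theorem IsSigned.isSchur {P K E : Finset ℕ} (h : IsSigned P K E) : IsSchur (realize P K E) := by
  refine ⟨fun x hx => ?_, fun x hx y hy hxy => ?_⟩
  · rcases mem_realize.1 hx with hx | ⟨k, hk, rfl⟩
    · have := h.five_le x hx; omega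
    · have := h.three_le k hk
      have := le_place E k
      omega
  rcases mem_realize.1 hx with hx | ⟨j, hj, rfl⟩ <;> rcases mem_realize.1 hy with hy | ⟨k, hk, rfl⟩
  · exact h.schur.2 x hx y hy hxy
  · have := h.sep x hx k hk
    have := le_place E k
    have := place_le E k
    exact ⟨by omega, fun hc => h.not_dvd x hx hc.1⟩
  · have := h.not_dvd y hy
    have := h.sep y hy j hj
    have := le_place E j
    have := place_le E j
    exact ⟨by omega, fun hc => by omega⟩
  · have hjk : j < k := by
      by_contra hc
      rcases Nat.lt_or_ge k j with h1 | h1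
      · have := h.gap k hk j hj h1
        have := le_place E j
        have := place_le E k
        omega
      · obtain rfl : j = k := by omega
        omega
    have hg := h.gap j hj k hk hjk
    have h1 := h.three_le j hj
    have h2 := le_place E k
    have h3 := place_le E j
    refine ⟨by omega, fun hc => ?_⟩
    have hjE : j ∈ E := by
      by_contra hjE
      rw [place_of_notMem hjE] at hc
      omega
    have hkE : k ∉ E := by
      intro hkE
      rw [place_of_mem hkE] at hc
      omega
    rw [place_of_mem hjE, place_of_notMem hkE] at hc
    have h4 : k = j + 4 := by omega
    have h5 : j ≠ 3 := by omega
    exact hkE (h.mono j hjE k hk ⟨by omega, 0, by simp, by simp, by omega⟩)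

namespace IsSigned

variable {P K E : Finset ℕ}

theorem mem_erase_iff (h : IsSigned P K E) {x : ℕ} :
    x ∈ (realize P K E).erase 4 ↔ x ∈ P ∨ ∃ k ∈ K, place E k = x ∧ ¬ (k = 3 ∧ k ∈ E) := by
  rw [Finset.mem_erase, mem_realize]
  constructor
  · rintro ⟨h4, hx | ⟨k, hk, rfl⟩⟩
    · exact Or.inl hx
    · refine Or.inr ⟨k, hk, rfl, ?_⟩
      rintro ⟨rfl, hE⟩
      exact h4 (place_of_mem hE)
  · rintro (hx | ⟨k, hk, rfl, hk3⟩)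
    · exact ⟨by have := h.five_le x hx; omega, Or.inl hx⟩
    · refine ⟨fun h4 => hk3 ?_, Or.inr ⟨k, hk, rfl⟩⟩
      have h1 := h.key_odd k hk
      have h2 := (even_place (E := E) h1).1 (by rw [h4]; decide)
      rw [place_of_mem h2] at h4
      exact ⟨by omega, h2⟩

theorem odd_add_notMem (h : IsSigned P K E) {k : ℕ} (hk : k ∈ K) :
    k + 3 ∉ (realize P K E).erase 4 := by
  rw [h.mem_erase_iff]
  rintro (hx | ⟨j, hj, e, -⟩)
  · have := h.sep _ hx k hk
    omega
  · have h1 := h.key_odd k hk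
    have h2 := h.key_odd j hj
    unfold place at e
    split_ifs at e
    · have := h.gap k hk j hj (by omega)
      omega
    · grind

theorem even_sub_notMem (h : IsSigned P K E) {k x : ℕ} (hk : k ∈ K) (hx : x + 2 = k) :
    x ∉ (realize P K E).erase 4 := by
  rw [h.mem_erase_iff]
  rintro (hx | ⟨j, hj, e, -⟩)
  · have := h.sep _ hx k hk
    omega
  · have h1 := h.key_odd k hk
    have h2 := h.key_odd j hj
    unfold place at e
    split_ifs at e
    · grind
    · have := h.gap j hj k hk (by omega)
      omega

theorem even_add_mem (h : IsSigned P K E) {k : ℕ} (hk : k ∈ E) (hk3 : k ≠ 3)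
    (hx : k + 4 ∈ (realize P K E).erase 4) : k + 4 ∈ P := by
  rcases h.mem_erase_iff.1 hx with hx | ⟨j, hj, e, -⟩
  · exact hx
  · exfalso
    have h1 := h.key_odd k (h.subset hk)
    have h2 := h.key_odd j hj
    have h3 := h.three_le k (h.subset hk)
    unfold place at e
    split_ifs at e with hjE
    · grind
    · exact hjE (h.mono k hk j hj ⟨by omega, 0, by simp, by simp, by omega⟩)

theorem odd_sub_mem (h : IsSigned P K E) {k x : ℕ} (hk : k ∈ K) (hkE : k ∉ E) (e : x + 3 = k)
    (hx : x ∈ (realize P K E).erase 4) : x ∈ P := by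
  rcases h.mem_erase_iff.1 hx with hx | ⟨j, hj, e', hj'⟩
  · exact hx
  · exfalso
    have h1 := h.key_odd k hk
    have h2 := h.key_odd j hj
    have h3 := h.three_le j hj
    unfold place at e'
    split_ifs at e' with hjE
    · exact hkE (h.mono j hjE k hk ⟨by grind, 0, by simp, by simp, by omega⟩)
    · grind

/-- The maximal run of the partition around a maximal run of paired parts. -/
theorem exists_run (h : IsSigned P K E) {a l : ℕ} (hr : IsMaxRun P a l) :
    IsMaxRun ((realize P K E).erase 4) a l ∨
      (Odd a ∧ a + 3 * l ∈ K ∧ a + 3 * l ∉ E ∧ IsMaxRun ((realize P K E).erase 4) a (l + 1)) ∨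
      ∃ k ∈ E, k ≠ 3 ∧ a = k + 4 ∧ IsMaxRun ((realize P K E).erase 4) (k + 1) (l + 1) := by
  have hsub : ∀ x ∈ P, x ∈ (realize P K E).erase 4 := fun x hx => h.mem_erase_iff.2 (Or.inl hx)
  have hle := h.even_run a l hr
  have hpred : ∀ b ∈ (realize P K E).erase 4, b + 3 = a → b ∈ E.image (· + 1) ∧ b ≠ 4 := by
    intro b hb e
    rcases h.mem_erase_iff.1 hb with hb | ⟨k, hk, rfl, hk3⟩
    · exact absurd e (hr.2.2.1 b hb)
    · have hkE : k ∈ E := by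
        by_contra hkE
        rw [place_of_notMem hkE] at e
        exact h.odd_add_notMem hk (e ▸ hsub a (by simpa using hr.mem hr.1))
      rw [place_of_mem hkE]
      exact ⟨Finset.mem_image_of_mem _ hkE, fun h4 => hk3 ⟨by omega, hkE⟩⟩
  have hsucc : a + 3 * l ∈ (realize P K E).erase 4 → a + 3 * l ∈ K ∧ a + 3 * l ∉ E := by
    intro hb
    rcases h.mem_erase_iff.1 hb with hb | ⟨k, hk, e, hk3⟩
    · exact absurd hb hr.2.2.2
    · have hkE : k ∉ E := by
        intro hkE
        rw [place_of_mem hkE] at e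
        have hl := hr.1
        exact h.even_sub_notMem (x := a + 3 * (l - 1)) hk (by omega) (hsub _ (hr.mem (by omega)))
      rw [place_of_notMem hkE] at e
      exact e ▸ ⟨hk, hkE⟩
  by_cases h1 : a + 3 * l ∈ (realize P K E).erase 4
  · obtain ⟨hK, hE⟩ := hsucc h1
    have hodd : Odd a := by have := h.key_odd _ hK; grind
    refine Or.inr (Or.inl ⟨hodd, hK, hE, by omega, fun i hi => ?_, fun b hb e => ?_, ?_⟩)
    · rcases Nat.lt_or_ge i l with hi' | hi'
      · exact hsub _ (hr.mem hi')
      · obtain rfl : i = l := by omega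
        exact h1
    · obtain ⟨hb', h4⟩ := hpred b hb e
      obtain ⟨k, hk, rfl⟩ := Finset.mem_image.1 hb'
      have := h.three_le k (h.subset hk)
      -- An even singleton below the run and an odd one above it would have linked keys, against
      -- monotonicity. Hence a run of paired parts is extended at one end at most.
      refine hE (h.mono k hk _ hK ⟨by omega, l, hle, fun i hi => ?_, by omega⟩)
      rw [show k + 4 + 3 * i = a + 3 * i by omega]
      exact hr.mem hi
    · rw [show a + 3 * (l + 1) = a + 3 * l + 3 by ring]
      exact h.odd_add_notMem hK
  · by_cases h2 : ∃ b ∈ (realize P K E).erase 4, b + 3 = a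
    · obtain ⟨b, hb, e⟩ := h2
      obtain ⟨hb', h4⟩ := hpred b hb e
      obtain ⟨k, hk, rfl⟩ := Finset.mem_image.1 hb'
      refine Or.inr (Or.inr ⟨k, hk, by omega, by omega, by omega, fun i hi => ?_,
        fun c hc hce => ?_, ?_⟩)
      · rcases i with _ | i
        · simpa using hb
        · rw [show k + 1 + 3 * (i + 1) = a + 3 * i by omega]
          exact hsub _ (hr.mem (by omega))
      · exact h.even_sub_notMem (h.subset hk) (by omega) hc
      · rwa [show k + 1 + 3 * (l + 1) = a + 3 * l by omega]
    · push Not at h2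
      exact Or.inl ⟨hr.1, fun i hi => hsub _ (hr.mem hi), h2, h1⟩

/-- A run of paired parts has even length and gains at most one singleton, an even one at the bottom
or an odd one at the top; in the resulting run of odd length precisely that end is unpaired. -/
theorem upperPaired_iff (h : IsSigned P K E) {x : ℕ} :
    UpperPaired ((realize P K E).erase 4) x ↔ x ∈ P := by
  constructor
  · intro hx
    rcases h.mem_erase_iff.1 hx.1 with hP | ⟨k, hk, rfl, hk3⟩
    · exact hP
    exfalso
    have hodd := h.key_odd k hk
    by_cases hkE : k ∈ E
    · rw [place_of_mem hkE] at hx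
      have h1 : ∀ y ∈ (realize P K E).erase 4, y + 3 ≠ k + 1 := fun y hy e =>
        h.even_sub_notMem hk (by omega) hy
      obtain ⟨a, l, i, hr, hi, e⟩ := exists_isMaxRun hx.1
      -- An even singleton has nothing at distance 3 below it, so it heads its run.
      obtain rfl : i = 0 := by
        by_contra hi0
        exact h1 _ (hr.mem (i := i - 1) (by omega)) (by omega)
      rw [e, SchurReduction.upperPaired_iff hr hi] at hx
      have hl1 := hr.mem hx.1
      rw [show a + 3 * 1 = k + 4 by omega] at hl1
      have hP := h.even_add_mem hkE (fun h3 => hk3 ⟨h3, hkE⟩) hl1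
      refine hx.2.2 ⟨?_, by grind, rfl⟩
      -- The rest of the run consists of paired parts: another singleton in it would be odd and
      -- last, its key would be linked to `k`, and monotonicity would make it even. So `l - 1` is
      -- even, and the even head of a run of odd length is unpaired.
      have hrP : IsMaxRun P (k + 4) (l - 1) := by
        refine ⟨by omega, fun j hj => ?_, fun b hb e' => ?_, fun hb => ?_⟩
        · have hm := hr.mem (i := j + 1) (by omega)
          rcases h.mem_erase_iff.1 hm with hm | ⟨k', hk', e', -⟩
          · convert hm using 1; omega
          · exfalso
            have hm0 := hr.mem (i := j) (by omega)
            have hodd' := h.key_odd k' hk'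
            by_cases hkE' : k' ∈ E
            · rw [place_of_mem hkE'] at e'
              exact h.even_sub_notMem hk' (by omega) hm0
            · rw [place_of_notMem hkE'] at e'
              by_cases hjl : j + 2 < l
              · have hm2 := hr.mem (i := j + 2) hjl
                exact h.odd_add_notMem hk' (by convert hm2 using 1; omega)
              · have hlink : Link P k k' := by
                  refine ⟨?_, j, by grind, fun i hij => ?_, by omega⟩
                  · have := h.three_le k hk
                    by_contra hc
                    exact hk3 ⟨by omega, hkE⟩
                  · have hm1 := hr.mem (i := i + 1) (by omega)
                    rcases h.mem_erase_iff.1 hm1 with hm1 | ⟨k'', hk'', e'', -⟩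
                    · convert hm1 using 1; omega
                    · exfalso
                      have hodd'' := h.key_odd k'' hk''
                      by_cases hkE'' : k'' ∈ E
                      · rw [place_of_mem hkE''] at e''
                        exact h.even_sub_notMem (x := a + 3 * i) hk'' (by omega)
                          (hr.mem (by omega))
                      · rw [place_of_notMem hkE''] at e''
                        have hm3 := hr.mem (i := i + 2) (by omega)
                        exact h.odd_add_notMem hk'' (by convert hm3 using 1; omega)
                exact hkE' (h.mono k hkE k' hk' hlink)
        · have := h.sep b hb k hk
          omega
        · refine hr.2.2.2 (h.mem_erase_iff.2 (Or.inl ?_))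
          convert hb using 1; omega
      have := h.even_run _ _ hrP
      grind
    · rw [place_of_notMem hkE] at hx
      have h1 := h.odd_add_notMem hk
      obtain ⟨a, l, i, hr, hi, e⟩ := exists_isMaxRun hx.1
      have hil : i + 1 = l := by
        by_contra hil
        exact h1 (by convert hr.mem (i := i + 1) (by omega) using 1; omega)
      rw [e, SchurReduction.upperPaired_iff hr hi] at hx
      have hl1 := hr.mem (i := i - 1) (by omega)
      have hP := h.odd_sub_mem hk hkE (by omega) hl1
      obtain ⟨a', l', i', hr', hi', e'⟩ := exists_isMaxRun hP
      have hkP : k ∉ P := by simpa [place_of_notMem hkE] using h.place_notMem hk E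
      have hil' : i' + 1 = l' := by
        by_contra hil'
        exact hkP (by convert hr'.mem (i := i' + 1) (by omega) using 1; omega)
      rcases h.exists_run hr' with h2 | ⟨h2, h3, h4, h5⟩ | ⟨k', h2, h3, h4, h5⟩
      · refine h2.2.2.2 ?_
        rw [show a' + 3 * l' = k by omega, h.mem_erase_iff]
        exact Or.inr ⟨k, hk, place_of_notMem hkE, hk3⟩
      · obtain ⟨rfl, rfl⟩ := hr.unique h5 hi (j := l') (by omega) (by omega)
        have := h.even_run _ _ hr'
        exact hx.2.1 ⟨by grind, h2, hil⟩
      · refine h5.2.2.2 ?_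
        rw [show k' + 1 + 3 * (l' + 1) = k by omega, h.mem_erase_iff]
        exact Or.inr ⟨k, hk, place_of_notMem hkE, hk3⟩
  · intro hx
    obtain ⟨a, l, i, hr, hi, rfl⟩ := exists_isMaxRun hx
    have hle := h.even_run a l hr
    have hl := hr.1
    rcases h.exists_run hr with h2 | ⟨h2, h3, h4, h5⟩ | ⟨k, h2, h3, h4, h5⟩
    · rw [SchurReduction.upperPaired_iff h2 hi]
      exact ⟨by grind, by grind, by grind⟩
    · rw [SchurReduction.upperPaired_iff h5 (by omega)]
      exact ⟨by omega, by omega, by grind⟩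
    · rw [show a + 3 * i = k + 1 + 3 * (i + 1) by omega,
        SchurReduction.upperPaired_iff h5 (by omega)]
      have := h.key_odd k (h.subset h2)
      exact ⟨by omega, by grind, by omega⟩

end IsSigned

/-! ### The configuration of a Schur partition -/

open Classical in
/-- The paired parts of `π`, where a part `4` is disregarded. -/
noncomputable def paired (π : Finset ℕ) : Finset ℕ := π.filter (UpperPaired (π.erase 4))

/-- The keys of the singletons of `π`. -/
noncomputable def keys (π : Finset ℕ) : Finset ℕ := (π \ paired π).image key

/-- The keys of the even singletons of `π`. -/
noncomputable def evenKeys (π : Finset ℕ) : Finset ℕ :=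
  ((π \ paired π).filter fun x => Even x).image key

theorem mem_paired {π : Finset ℕ} {x : ℕ} : x ∈ paired π ↔ UpperPaired (π.erase 4) x := by
  simp only [paired, Finset.mem_filter, and_iff_right_iff_imp]
  exact fun h => (Finset.mem_erase.1 h.1).2

theorem mem_keys {π : Finset ℕ} {k : ℕ} : k ∈ keys π ↔ ∃ x ∈ π, x ∉ paired π ∧ key x = k := by
  simp [keys, and_assoc]

theorem mem_evenKeys {π : Finset ℕ} {k : ℕ} :
    k ∈ evenKeys π ↔ ∃ x ∈ π, x ∉ paired π ∧ Even x ∧ key x = k := by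
  simp [evenKeys, and_assoc]

theorem paired_subset (π : Finset ℕ) : paired π ⊆ π := fun _ hx =>
  Finset.mem_of_mem_erase (mem_paired.1 hx).1

theorem odd_add_notMem_of_notMem_paired {π : Finset ℕ} {x : ℕ} (hx : x ∈ π) (hx' : x ∉ paired π)
    (ho : Odd x) (h1 : x ≠ 1) : x + 3 ∉ π := by
  intro h
  refine hx' (mem_paired.2 (upperPaired_of_odd_of_add ?_ ho ?_)) <;> rw [Finset.mem_erase]
  · exact ⟨by rintro rfl; revert ho; decide, hx⟩
  · exact ⟨by omega, h⟩

theorem even_sub_notMem_of_notMem_paired {π : Finset ℕ} {x : ℕ} (hx : x + 3 ∈ π)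
    (hx' : x + 3 ∉ paired π) (ho : Even (x + 3)) (h1 : x ≠ 1) : x ∉ π := by
  intro h
  refine hx' (mem_paired.2 (upperPaired_of_even_of_sub ?_ ho ?_)) <;> rw [Finset.mem_erase]
  · exact ⟨by omega, hx⟩
  · exact ⟨by rintro rfl; revert ho; decide, h⟩

theorem key_inj_of_isSchur {π : Finset ℕ} (hS : IsSchur π) {x y : ℕ} (hx : x ∈ π) (hy : y ∈ π)
    (e : key x = key y) : x = y := by
  have := key_le x
  have := le_key x
  have := key_le y
  have := le_key y
  by_contra hne
  rcases Nat.lt_or_gt_of_ne hne with h | h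
  · have := (hS.2 x hx y hy h).1
    omega
  · have := (hS.2 y hy x hx h).1
    omega

/-- An odd singleton has no part 3 above it and an even singleton none 3 below, apart from an
interaction with the ignored part 4 that parity or `3 ≤ x` rules out. Translated to keys, these
facts give the same bounds `gap` and `sep` for both signs. -/
theorem isSigned_of_isSchur {π : Finset ℕ} (hS : IsSchur π) (h3 : ∀ x ∈ π, 3 ≤ x) :
    IsSigned (paired π) (keys π) (evenKeys π) := by
  have hsub := paired_subset π
  have hE : ∀ x ∈ π, x ∉ paired π → (key x ∈ evenKeys π ↔ Even x) := by
    intro x hx hx'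
    rw [mem_evenKeys]
    constructor
    · rintro ⟨y, hy, -, hey, e⟩
      rwa [← key_inj_of_isSchur hS hy hx e]
    · exact fun he => ⟨x, hx, hx', he, rfl⟩
  -- The part 4 is erased, and 3 could pair only with 6, a consecutive multiple of 3.
  have hfour : ∀ q ∈ paired π, 5 ≤ q := by
    intro q hq
    obtain ⟨hq0, hq1, hq2⟩ := mem_paired.1 hq
    rw [Finset.mem_erase] at hq0
    have := h3 q hq0.2
    by_contra hc
    obtain rfl : q = 3 := by omega
    rcases hq1 with hq1 | ⟨y, hy, e⟩
    · exact (hS.2 3 hq0.2 6 (Finset.mem_of_mem_erase hq1) (by omega)).2 ⟨by omega, rfl⟩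
    · have := h3 y (Finset.mem_of_mem_erase hy)
      omega
  refine ⟨⟨hfour, ⟨fun x hx => hS.1 x (hsub hx), fun x hx y hy => hS.2 x (hsub hx) y (hsub hy)⟩,
    ?_, ?_, ?_, ?_, ?_, ?_⟩, ?_, ?_⟩
  · intro q hq hd
    obtain ⟨hq0, hq1, hq2⟩ := mem_paired.1 hq
    rw [Finset.mem_erase] at hq0
    rcases hq1 with hq1 | ⟨y, hy, e⟩
    · exact (hS.2 q hq0.2 _ (Finset.mem_of_mem_erase hq1) (by omega)).2 ⟨hd, rfl⟩
    · exact (hS.2 y (Finset.mem_of_mem_erase hy) q hq0.2 (by omega)).2 ⟨by omega, e.symm⟩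
  · intro a l hr
    have ha := hr.mem hr.1
    rw [mul_zero, add_zero] at ha
    obtain ⟨b, m, i, hb, hi, e⟩ := exists_isMaxRun (mem_paired.1 ha).1
    have hm : ∀ j < m, (b + 3 * j ∈ paired π ↔
        1 < m ∧ ¬ (Odd m ∧ Odd b ∧ j + 1 = m) ∧ ¬ (Odd m ∧ Even b ∧ j = 0)) := fun j hj =>
      mem_paired.trans (upperPaired_iff hb hj)
    have hpm : ∀ x ∈ paired π, x ∈ π.erase 4 := fun x hx => (mem_paired.1 hx).1
    have hai := (hm i hi).1 (e ▸ ha)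
    -- An even run of parts is paired throughout; an odd one loses its even first or its odd last
    -- member. The remainder has even length in every case.
    rcases Nat.even_or_odd m with hem | hom
    · have hr' : IsMaxRun (paired π) b m :=
        ⟨hb.1, fun j hj => (hm j hj).2 ⟨by omega, by grind, by grind⟩,
          fun c hc => hb.2.2.1 c (hpm c hc), fun hc => hb.2.2.2 (hpm _ hc)⟩
      obtain ⟨-, rfl⟩ := hr.unique hr' hr.1 hi (by omega)
      exact hem
    · rcases Nat.even_or_odd b with heb | hob
      · have hr' : IsMaxRun (paired π) (b + 3) (m - 1) := by
          refine ⟨by omega, fun j hj => ?_, fun c hc hcb => ?_, fun hc => ?_⟩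
          · have := (hm (j + 1) (by omega)).2 ⟨by omega, by grind, by grind⟩
            convert this using 1; ring
          · obtain rfl : c = b := by omega
            exact ((hm 0 (by omega)).1 (by simpa using hc)).2.2 ⟨hom, heb, rfl⟩
          · refine hb.2.2.2 (hpm _ ?_)
            convert hc using 1; omega
        obtain ⟨-, rfl⟩ := hr.unique hr' hr.1 (j := i - 1) (by grind) (by grind)
        grind
      · have hr' : IsMaxRun (paired π) b (m - 1) := by
          refine ⟨by omega, fun j hj => ?_, fun c hc => hb.2.2.1 c (hpm c hc), fun hc => ?_⟩
          · exact (hm j (by omega)).2 ⟨by omega, by grind, by grind⟩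
          · exact ((hm (m - 1) (by omega)).1 hc).2.1 ⟨hom, hob, by omega⟩
        obtain ⟨-, rfl⟩ := hr.unique hr' hr.1 (j := i) (by grind) (by omega)
        grind
  · intro k hk
    obtain ⟨x, hx, -, rfl⟩ := mem_keys.1 hk
    exact odd_key (hS.1 x hx)
  · intro k hk
    obtain ⟨x, hx, -, rfl⟩ := mem_keys.1 hk
    have := h3 x hx
    rcases Nat.even_or_odd x with h | h
    · rw [key_of_even h]; grind
    · rwa [key_of_odd h]
  · intro j hj k hk hjk
    obtain ⟨x, hx, hx', rfl⟩ := mem_keys.1 hj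
    obtain ⟨y, hy, hy', rfl⟩ := mem_keys.1 hk
    have hxy : x < y := by
      by_contra hc
      rcases Nat.lt_or_ge y x with h | h
      · have := (hS.2 y hy x hx h).1
        have := key_le y
        have := le_key x
        omega
      · obtain rfl : x = y := by omega
        omega
    have h1 := (hS.2 x hx y hy hxy).1
    have h2 := h3 x hx
    have h4 : Odd x → y ≠ x + 3 := fun ho e =>
      odd_add_notMem_of_notMem_paired hx hx' ho (by omega) (e ▸ hy)
    rcases Nat.even_or_odd x with hex | hox <;> rcases Nat.even_or_odd y with hey | hoy
    · rw [key_of_even hex, key_of_even hey]; grind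
    · rw [key_of_even hex, key_of_odd hoy]; omega
    · rw [key_of_odd hox, key_of_even hey]; grind
    · rw [key_of_odd hox, key_of_odd hoy]; grind
  · intro q hq k hk
    obtain ⟨x, hx, hx', rfl⟩ := mem_keys.1 hk
    have hq5 := hfour q hq
    have h2 := h3 x hx
    rcases lt_trichotomy x q with h | rfl | h
    · left
      have h1 := (hS.2 x hx q (hsub hq) h).1
      rcases Nat.even_or_odd x with hex | hox
      · rw [key_of_even hex]; omega
      · rw [key_of_odd hox]
        have : q ≠ x + 3 := fun e =>
          odd_add_notMem_of_notMem_paired hx hx' hox (by omega) (e ▸ hsub hq)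
        omega
    · exact absurd hq hx'
    · right
      have h1 := (hS.2 q (hsub hq) x hx h).1
      rcases Nat.even_or_odd x with hex | hox
      · rw [key_of_even hex]
        have : x ≠ q + 3 := by
          rintro rfl
          exact even_sub_notMem_of_notMem_paired hx hx' hex (by omega) (hsub hq)
        omega
      · rwa [key_of_odd hox]
  · intro k hk
    obtain ⟨x, hx, hx', -, e⟩ := mem_evenKeys.1 hk
    exact mem_keys.2 ⟨x, hx, hx', e⟩
  · rintro j hj k hk ⟨hj3, p, hp, hpP, rfl⟩
    obtain ⟨x, hx, hx', hex, rfl⟩ := mem_evenKeys.1 hj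
    obtain ⟨y, hy, hy', e⟩ := mem_keys.1 hk
    rw [← e, hE y hy hy']
    by_contra hoy
    rw [Nat.not_even_iff_odd] at hoy
    rw [key_of_even hex] at hj3 e hpP
    rw [key_of_odd hoy] at e
    -- An even `x`, the `p` paired parts and an odd `y` would form one run of even length, in which
    -- `x` is paired.
    have hr : IsMaxRun (π.erase 4) x (p + 2) := by
      refine ⟨by omega, fun i hi => ?_, fun b hb hbe => ?_, fun hc => ?_⟩
      · rw [Finset.mem_erase]
        refine ⟨by omega, ?_⟩
        rcases i with _ | i
        · simpa using hx
        · rcases Nat.lt_or_ge i p with hip | hip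
          · convert hsub (hpP i hip) using 1; omega
          · convert hy using 1; omega
      · obtain rfl : x = b + 3 := by omega
        exact even_sub_notMem_of_notMem_paired hx hx' hex (by omega) (Finset.mem_of_mem_erase hb)
      · refine odd_add_notMem_of_notMem_paired hy hy' hoy (by omega) ?_
        convert Finset.mem_of_mem_erase hc using 1
        omega
    refine hx' (mem_paired.2 ?_)
    have := (upperPaired_iff hr (i := 0) (by omega)).2 ⟨by omega, by grind, by grind⟩
    simpa using this

theorem realize_paired {π : Finset ℕ} (hS : IsSchur π) :
    realize (paired π) (keys π) (evenKeys π) = π := by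
  have hsub := paired_subset π
  have hpl : ∀ x ∈ π, x ∉ paired π → place (evenKeys π) (key x) = x := by
    intro x hx hx'
    by_cases he : Even x
    · rw [place_of_mem (mem_evenKeys.2 ⟨x, hx, hx', he, rfl⟩), key_of_even he]
      have := hS.1 x hx
      omega
    · rw [place_of_notMem, key_of_odd (Nat.not_even_iff_odd.1 he)]
      intro hc
      obtain ⟨y, hy, -, hey, e⟩ := mem_evenKeys.1 hc
      rw [key_inj_of_isSchur hS hy hx e] at hey
      exact he hey
  ext x
  rw [mem_realize]
  constructor
  · rintro (hx | ⟨k, hk, rfl⟩)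
    · exact hsub hx
    · obtain ⟨x, hx, hx', rfl⟩ := mem_keys.1 hk
      rwa [hpl x hx hx']
  · intro hx
    by_cases hx' : x ∈ paired π
    · exact Or.inl hx'
    · exact Or.inr ⟨key x, mem_keys.2 ⟨x, hx, hx', rfl⟩, hpl x hx hx'⟩

namespace IsSigned

variable {P K E : Finset ℕ}

theorem paired_realize (h : IsSigned P K E) : paired (realize P K E) = P := by
  ext x
  rw [mem_paired, h.upperPaired_iff]

theorem mem_realize_sdiff (h : IsSigned P K E) {x : ℕ} :
    x ∈ realize P K E ∧ x ∉ P ↔ ∃ k ∈ K, place E k = x := by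
  rw [mem_realize]
  constructor
  · tauto
  · rintro ⟨k, hk, rfl⟩
    exact ⟨Or.inr ⟨k, hk, rfl⟩, h.place_notMem hk E⟩

theorem keys_realize (h : IsSigned P K E) : keys (realize P K E) = K := by
  ext k
  rw [mem_keys, h.paired_realize]
  constructor
  · rintro ⟨x, hx, hx', rfl⟩
    obtain ⟨k, hk, rfl⟩ := h.mem_realize_sdiff.1 ⟨hx, hx'⟩
    rwa [key_place (h.key_odd k hk)]
  · intro hk
    obtain ⟨h1, h2⟩ := h.mem_realize_sdiff.2 ⟨k, hk, rfl⟩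
    exact ⟨_, h1, h2, key_place (h.key_odd k hk)⟩

theorem evenKeys_realize (h : IsSigned P K E) : evenKeys (realize P K E) = E := by
  ext k
  rw [mem_evenKeys, h.paired_realize]
  constructor
  · rintro ⟨x, hx, hx', he, rfl⟩
    obtain ⟨k, hk, rfl⟩ := h.mem_realize_sdiff.1 ⟨hx, hx'⟩
    rw [key_place (h.key_odd k hk)]
    rwa [even_place (h.key_odd k hk)] at he
  · intro hk
    obtain ⟨h1, h2⟩ := h.mem_realize_sdiff.2 ⟨k, h.subset hk, rfl⟩
    exact ⟨_, h1, h2, (even_place (h.key_odd k (h.subset hk))).2 hk,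
      key_place (h.key_odd k (h.subset hk))⟩

theorem three_le_of_mem (h : IsSigned P K E) {x : ℕ} (hx : x ∈ realize P K E) : 3 ≤ x := by
  rcases mem_realize.1 hx with hx | ⟨k, hk, rfl⟩
  · have := h.five_le x hx; omega
  · exact (h.three_le k hk).trans (le_place E k)

end IsSigned

/-! ### Clusters of singletons and the exchange of signs -/

/-- Whether some key is linked to `j` from above. -/
def Tight (P K : Finset ℕ) (j : ℕ) : Prop := ∃ k ∈ K, Link P j k

/-- All keys from the smaller to the larger of `j` and `k` are tight, the larger excepted. -/
def SameCluster (P K : Finset ℕ) (j k : ℕ) : Prop :=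
  ∀ i ∈ K, min j k ≤ i → i < max j k → Tight P K i

open Classical in
/-- The cluster of a key. -/
noncomputable def cluster (P K : Finset ℕ) (k : ℕ) : Finset ℕ := K.filter (SameCluster P K k)

theorem SameCluster.refl (P K : Finset ℕ) (k : ℕ) : SameCluster P K k k := by
  intro i _ h1 h2
  omega

theorem SameCluster.symm {P K : Finset ℕ} {j k : ℕ} (h : SameCluster P K j k) :
    SameCluster P K k j := by
  intro i hi h1 h2
  exact h i hi (by omega) (by omega)

theorem SameCluster.trans {P K : Finset ℕ} {i j k : ℕ} (h : SameCluster P K i j)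
    (h' : SameCluster P K j k) : SameCluster P K i k := by
  intro n hn h1 h2
  by_cases hc : min i j ≤ n ∧ n < max i j
  · exact h n hn hc.1 hc.2
  · exact h' n hn (by omega) (by omega)

theorem mem_cluster {P K : Finset ℕ} {j k : ℕ} : j ∈ cluster P K k ↔ j ∈ K ∧ SameCluster P K k j := by
  simp [cluster]

theorem cluster_subset (P K : Finset ℕ) (k : ℕ) : cluster P K k ⊆ K :=
  fun _ hj => (mem_cluster.1 hj).1

theorem cluster_eq {P K : Finset ℕ} {j k : ℕ} (h : SameCluster P K k j) :
    cluster P K j = cluster P K k := by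
  ext i
  simp only [mem_cluster]
  exact and_congr_right fun _ => ⟨fun h' => h.trans h', fun h' => h.symm.trans h'⟩

theorem SameCluster.of_le {P K : Finset ℕ} {i j k : ℕ} (h : SameCluster P K i k) (h1 : i ≤ j)
    (h2 : j ≤ k) : SameCluster P K i j := by
  intro n hn h3 h4
  exact h n hn (by omega) (by omega)

/-- Signs are monotone on clusters. -/
theorem IsSigned.mem_of_sameCluster {P K E : Finset ℕ} (h : IsSigned P K E) {j k : ℕ} (hj : j ∈ E)
    (hk : k ∈ K) (hjk : j ≤ k) (hc : SameCluster P K j k) : k ∈ E := by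
  induction hn : k - j using Nat.strong_induction_on generalizing j with
  | _ n ih =>
    rcases Nat.eq_or_lt_of_le hjk with rfl | hlt
    · exact hj
    · obtain ⟨j', hj', hl⟩ := hc j (h.subset hj) (by omega) (by omega)
      have h1 := h.le_of_link (h.subset hj) hl hk hlt
      have h2 : j < j' := by obtain ⟨-, p, -, -, rfl⟩ := hl; omega
      refine ih (k - j') (by omega) (h.mono j hj j' hj' hl) h1 ?_ rfl
      intro n hn h3 h4
      exact hc n hn (by omega) (by omega)

/-- The exchange of the numbers of odd and of even singletons in each cluster. -/
noncomputable def flip (P K E : Finset ℕ) : Finset ℕ :=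
  K.filter fun k =>
    (cluster P K k ∩ E).card ≤ ((cluster P K k).filter (· < k)).card

theorem mem_flip {P K E : Finset ℕ} {k : ℕ} : k ∈ flip P K E ↔
    k ∈ K ∧ (cluster P K k ∩ E).card ≤ ((cluster P K k).filter (· < k)).card := by
  simp [flip]

/-- Ranks run through `0, …, C.card - 1`. With `b` the number of even signs in a cluster, this is
the size of the flipped sign set. -/
theorem card_filter_rank (C : Finset ℕ) {b : ℕ} (hb : b ≤ C.card) :
    (C.filter fun k => b ≤ (C.filter (· < k)).card).card = C.card - b := by
  induction C using Finset.induction_on_max generalizing b with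
  | empty => simp
  | insert a C hC ih =>
    have ha : a ∉ C := fun h => (hC a h).false
    have e1 : (insert a C).filter (· < a) = C := by
      ext x
      simp only [Finset.mem_filter, Finset.mem_insert]
      constructor
      · rintro ⟨rfl | h, h'⟩
        · omega
        · exact h
      · exact fun h => ⟨Or.inr h, hC x h⟩
    have e2 : ∀ k ∈ C, (insert a C).filter (· < k) = C.filter (· < k) := by
      intro k hk
      rw [Finset.filter_insert, if_neg]
      have := hC k hk
      omega
    rw [Finset.card_insert_of_notMem ha] at hb ⊢
    rw [Finset.filter_insert, e1]
    have e3 : (C.filter fun k => b ≤ ((insert a C).filter (· < k)).card) =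
        C.filter fun k => b ≤ (C.filter (· < k)).card :=
      Finset.filter_congr fun k hk => by rw [e2 k hk]
    rw [e3]
    split_ifs with h
    · rw [Finset.card_insert_of_notMem (by simp [ha]), ih h]
      omega
    · have : C.filter (fun k => b ≤ (C.filter (· < k)).card) = ∅ := by
        rw [Finset.filter_eq_empty_iff]
        intro k hk hc
        have := Finset.card_le_card (Finset.filter_subset (· < k) C)
        omega
      rw [this]
      simp
      omega

/-- An upper set consists of the elements of highest rank, so its size determines it; this is what
makes `flip` an involution. -/
theorem mem_iff_rank {C U : Finset ℕ} (hU : ∀ j ∈ C ∩ U, ∀ k ∈ C, j ≤ k → k ∈ U) {k : ℕ}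
    (hk : k ∈ C) : k ∈ U ↔ C.card - (C ∩ U).card ≤ (C.filter (· < k)).card := by
  have h1 := Finset.card_sdiff_add_card_inter C U
  constructor
  · intro hkU
    have : C \ U ⊆ C.filter (· < k) := by
      intro x hx
      rw [Finset.mem_sdiff] at hx
      rw [Finset.mem_filter]
      refine ⟨hx.1, ?_⟩
      by_contra hc
      exact hx.2 (hU k (Finset.mem_inter.2 ⟨hk, hkU⟩) x hx.1 (by omega))
    have := Finset.card_le_card this
    omega
  · intro hle
    by_contra hkU
    have : insert k (C.filter (· < k)) ⊆ C \ U := by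
      intro x hx
      rw [Finset.mem_insert, Finset.mem_filter] at hx
      rw [Finset.mem_sdiff]
      rcases hx with rfl | hx
      · exact ⟨hk, hkU⟩
      · exact ⟨hx.1, fun hxU => hkU (hU x (Finset.mem_inter.2 ⟨hx.1, hxU⟩) k hk hx.2.le)⟩
    have := Finset.card_le_card this
    rw [Finset.card_insert_of_notMem (by simp)] at this
    omega

theorem mem_cluster_self {P K : Finset ℕ} {k : ℕ} (hk : k ∈ K) : k ∈ cluster P K k :=
  mem_cluster.2 ⟨hk, SameCluster.refl P K k⟩

theorem mem_cluster_iff_eq {P K : Finset ℕ} {j k : ℕ} (hj : j ∈ K) :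
    j ∈ cluster P K k ↔ cluster P K j = cluster P K k :=
  ⟨fun h => cluster_eq (mem_cluster.1 h).2, fun h => h ▸ mem_cluster_self hj⟩

theorem mem_flip_of_sameCluster {P K E : Finset ℕ} {j k : ℕ} (hj : j ∈ flip P K E) (hk : k ∈ K)
    (hjk : j ≤ k) (hc : SameCluster P K j k) : k ∈ flip P K E := by
  rw [mem_flip] at hj ⊢
  refine ⟨hk, ?_⟩
  rw [cluster_eq hc]
  refine hj.2.trans (Finset.card_le_card fun x hx => ?_)
  rw [Finset.mem_filter] at hx ⊢
  exact ⟨hx.1, by omega⟩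

theorem IsConfig.sameCluster_of_link {P K : Finset ℕ} (h : IsConfig P K) {j k : ℕ} (hj : j ∈ K)
    (hk : k ∈ K) (hl : Link P j k) : SameCluster P K j k := by
  have hlt : j < k := by obtain ⟨-, p, -, -, rfl⟩ := hl; omega
  intro i hi h1 h2
  rcases Nat.eq_or_lt_of_le (show j ≤ i by omega) with rfl | h3
  · exact ⟨k, hk, hl⟩
  · have := h.le_of_link hj hl hi h3
    omega

theorem card_cluster_inter_flip {P K : Finset ℕ} (E : Finset ℕ) (k : ℕ) :
    (cluster P K k ∩ flip P K E).card = (cluster P K k).card - (cluster P K k ∩ E).card := by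
  rw [← card_filter_rank _ (Finset.card_le_card Finset.inter_subset_left)]
  congr 1
  ext x
  rw [Finset.mem_inter, Finset.mem_filter]
  refine and_congr_right fun hx => ?_
  have hxK := cluster_subset P K k hx
  rw [mem_flip, (mem_cluster_iff_eq hxK).1 hx]
  exact and_iff_right hxK

theorem IsSigned.flip {P K E : Finset ℕ} (h : IsSigned P K E) :
    IsSigned P K (flip P K E) := by
  refine ⟨h.toIsConfig, Finset.filter_subset _ _, fun j hj k hk hl => ?_⟩
  have hjK := (mem_flip.1 hj).1
  exact mem_flip_of_sameCluster hj hk (by obtain ⟨-, p, -, -, rfl⟩ := hl; omega)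
    (h.sameCluster_of_link hjK hk hl)

theorem IsSigned.mem_iff_rank {P K E : Finset ℕ} (h : IsSigned P K E) {k : ℕ} (hk : k ∈ K) :
    k ∈ E ↔ (cluster P K k).card - (cluster P K k ∩ E).card ≤
      ((cluster P K k).filter (· < k)).card := by
  refine SchurReduction.mem_iff_rank (fun i hi j hj hij => ?_) (mem_cluster_self hk)
  rw [Finset.mem_inter] at hi
  exact h.mem_of_sameCluster hi.2 (cluster_subset _ _ _ hj) hij
    ((mem_cluster.1 hi.1).2.symm.trans (mem_cluster.1 hj).2)

theorem IsSigned.flip_flip {P K E : Finset ℕ} (h : IsSigned P K E) :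
    SchurReduction.flip P K (SchurReduction.flip P K E) = E := by
  ext k
  rw [mem_flip, card_cluster_inter_flip]
  constructor
  · rintro ⟨hk, hle⟩
    exact (h.mem_iff_rank hk).2 hle
  · intro hk
    exact ⟨h.subset hk, (h.mem_iff_rank (h.subset hk)).1 hk⟩

theorem card_eq_sum_cluster {P K E : Finset ℕ} (hE : E ⊆ K) :
    E.card = ∑ c ∈ K.image (cluster P K), (c ∩ E).card := by
  rw [Finset.card_eq_sum_card_fiberwise (f := cluster P K) (t := K.image (cluster P K))
    fun x hx => by simpa using ⟨x, hE hx, rfl⟩]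
  refine Finset.sum_congr rfl fun c hc => ?_
  obtain ⟨k, hk, rfl⟩ := Finset.mem_image.1 hc
  congr 1
  ext x
  rw [Finset.mem_filter, Finset.mem_inter, and_comm]
  refine and_congr_left fun hx => (mem_cluster_iff_eq (hE hx)).symm

theorem card_flip {P K E : Finset ℕ} (hE : E ⊆ K) : (flip P K E).card + E.card = K.card := by
  have h1 : flip P K E ⊆ K := Finset.filter_subset _ _
  rw [card_eq_sum_cluster (P := P) h1, card_eq_sum_cluster (P := P) hE,
    card_eq_sum_cluster (P := P) (Finset.Subset.refl K), ← Finset.sum_add_distrib]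
  refine Finset.sum_congr rfl fun c hc => ?_
  obtain ⟨k, hk, rfl⟩ := Finset.mem_image.1 hc
  rw [card_cluster_inter_flip, Finset.inter_eq_left.2 (cluster_subset P K k)]
  exact Nat.sub_add_cancel (Finset.card_le_card Finset.inter_subset_left)

/-! ### Upper minimal segments, built one singleton at a time -/

theorem mem_progression {a d l x : ℕ} : x ∈ progression a d l ↔ ∃ i < l, a + d * i = x := by
  simp [progression]

theorem progression_zero (a d : ℕ) : progression a d 0 = ∅ := rfl

theorem progression_one (a d : ℕ) : progression a d 1 = {a} := by simp [progression]

theorem progression_succ (a d l : ℕ) :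
    progression a d (l + 1) = progression a d l ∪ {a + d * l} := by
  ext x
  simp only [Finset.mem_union, mem_progression, Finset.mem_singleton]
  constructor
  · rintro ⟨i, hi, rfl⟩
    rcases Nat.lt_or_ge i l with h | h
    · exact Or.inl ⟨i, h, rfl⟩
    · obtain rfl : i = l := by omega
      exact Or.inr rfl
  · rintro (⟨i, hi, rfl⟩ | rfl)
    · exact ⟨i, by omega, rfl⟩
    · exact ⟨l, by omega, rfl⟩

theorem progression_succ_left (a d l : ℕ) :
    progression a d (l + 1) = {a} ∪ progression (a + d) d l := by
  ext x
  simp only [Finset.mem_union, mem_progression, Finset.mem_singleton]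
  constructor
  · rintro ⟨i, hi, rfl⟩
    rcases i with _ | i
    · exact Or.inl (by simp)
    · exact Or.inr ⟨i, by omega, by ring⟩
  · rintro (rfl | ⟨i, hi, rfl⟩)
    · exact ⟨0, by omega, by simp⟩
    · exact ⟨i + 1, by omega, by ring⟩

/-- `Segment o e S`: the set `S` is an upper minimal segment with smallest part `o` and largest
part `e`, built up by adjoining one singleton at a time. -/
inductive Segment : ℕ → ℕ → Finset ℕ → Prop
  | base (o p : ℕ) (ho : Odd o) (ho3 : 3 < o) (hp : Even p) (h3 : 0 < p → ¬ 3 ∣ o + 1) :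
      Segment o (o + 5 + 3 * p) ({o} ∪ progression (o + 4) 3 p ∪ {o + 5 + 3 * p})
  | right (o e p : ℕ) (S : Finset ℕ) (hS : Segment o e S) (hp : Even p) (h3 : 0 < p → ¬ 3 ∣ e) :
      Segment o (e + 4 + 3 * p) (S ∪ progression (e + 3) 3 p ∪ {e + 4 + 3 * p})
  | left (o o' e p : ℕ) (S : Finset ℕ) (hS : Segment o' e S) (he : o' = o + 4 + 3 * p)
      (ho : Odd o) (ho3 : 3 < o) (hp : Even p) (h3 : 0 < p → ¬ 3 ∣ o') :
      Segment o e ({o} ∪ progression (o + 4) 3 p ∪ S)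

namespace Segment

variable {o e : ℕ} {S : Finset ℕ}

theorem odd_even (h : Segment o e S) : Odd o ∧ Even e ∧ 3 < o ∧ o < e := by
  induction h with
  | base o p ho ho3 hp h3 => exact ⟨ho, by grind, ho3, by omega⟩
  | right o e p S hS hp h3 ih => exact ⟨ih.1, by grind, ih.2.2.1, by omega⟩
  | left o o' e p S hS he ho ho3 hp h3 ih => exact ⟨ho, ih.2.1, ho3, by omega⟩

theorem mem_ends (h : Segment o e S) : o ∈ S ∧ e ∈ S ∧ ∀ x ∈ S, o ≤ x ∧ x ≤ e := by
  induction h with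
  | base o p ho ho3 hp h3 =>
    refine ⟨by simp, by simp, fun x hx => ?_⟩
    simp only [Finset.mem_union, mem_progression, Finset.mem_singleton] at hx
    rcases hx with (rfl | ⟨i, hi, rfl⟩) | rfl <;> omega
  | right o e p S hS hp h3 ih =>
    refine ⟨by simp [ih.1], by simp, fun x hx => ?_⟩
    have h1 := hS.odd_even
    simp only [Finset.mem_union, mem_progression, Finset.mem_singleton] at hx
    rcases hx with (hx | ⟨i, hi, rfl⟩) | rfl
    · have := ih.2.2 x hx; omega
    · omega
    · omega
  | left o o' e p S hS he ho ho3 hp h3 ih =>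
    refine ⟨by simp, by simp [ih.2.1], fun x hx => ?_⟩
    have h1 := hS.odd_even
    simp only [Finset.mem_union, mem_progression, Finset.mem_singleton] at hx
    rcases hx with (rfl | ⟨i, hi, rfl⟩) | hx
    · omega
    · omega
    · have := ih.2.2 x hx; omega

theorem isLeast (h : Segment o e S) : IsLeast (S : Set ℕ) o :=
  ⟨h.mem_ends.1, fun x hx => (h.mem_ends.2.2 x hx).1⟩

theorem isGreatest (h : Segment o e S) : IsGreatest (S : Set ℕ) e :=
  ⟨h.mem_ends.2.1, fun x hx => (h.mem_ends.2.2 x hx).2⟩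

/-- There is no gap above `5`, and none of `3` after the smallest or before the largest part. -/
theorem gaps (h : Segment o e S) : (∀ x ∈ S, x < e → ∃ y ∈ S, x < y ∧ y ≤ x + 5) ∧
    (o + 4 ∈ S ∨ o + 5 ∈ S) ∧ ∃ z ∈ S, z + 4 = e ∨ z + 5 = e := by
  induction h with
  | base o p ho ho3 hp h3 =>
    simp only [Finset.mem_union, mem_progression, Finset.mem_singleton]
    refine ⟨?_, ?_, ?_⟩
    · rintro x ((rfl | ⟨i, hi, rfl⟩) | rfl) hx
      · rcases Nat.eq_zero_or_pos p with rfl | hp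
        · exact ⟨_, Or.inr rfl, by omega, by omega⟩
        · exact ⟨x + 4, Or.inl (Or.inr ⟨0, hp, by omega⟩), by omega, by omega⟩
      · by_cases hi' : i + 1 < p
        · exact ⟨_, Or.inl (Or.inr ⟨i + 1, hi', rfl⟩), by omega, by omega⟩
        · exact ⟨_, Or.inr rfl, by omega, by omega⟩
      · omega
    · rcases Nat.eq_zero_or_pos p with rfl | hp
      · exact Or.inr (by simp)
      · exact Or.inl (Or.inl (Or.inr ⟨0, hp, by omega⟩))
    · rcases Nat.eq_zero_or_pos p with rfl | hp
      · exact ⟨o, by simp, by omega⟩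
      · exact ⟨_, Or.inl (Or.inr ⟨p - 1, by omega, rfl⟩), by omega⟩
  | right o e p S hS hp h3 ih =>
    simp only [Finset.mem_union, mem_progression, Finset.mem_singleton]
    refine ⟨?_, ?_, ?_⟩
    · rintro x ((hx | ⟨i, hi, rfl⟩) | rfl) hxe
      · by_cases hx' : x < e
        · obtain ⟨y, hy, hy'⟩ := ih.1 x hx hx'
          exact ⟨y, Or.inl (Or.inl hy), hy'⟩
        · have := (hS.mem_ends.2.2 x hx).2
          rcases Nat.eq_zero_or_pos p with rfl | hp
          · exact ⟨_, Or.inr rfl, by omega, by omega⟩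
          · exact ⟨e + 3, Or.inl (Or.inr ⟨0, hp, by omega⟩), by omega, by omega⟩
      · by_cases hi' : i + 1 < p
        · exact ⟨_, Or.inl (Or.inr ⟨i + 1, hi', rfl⟩), by omega, by omega⟩
        · exact ⟨_, Or.inr rfl, by omega, by omega⟩
      · omega
    · tauto
    · rcases Nat.eq_zero_or_pos p with rfl | hp
      · exact ⟨e, Or.inl (Or.inl hS.mem_ends.2.1), by omega⟩
      · exact ⟨_, Or.inl (Or.inr ⟨p - 1, by omega, rfl⟩), by omega⟩
  | left o o' e p S hS he ho ho3 hp h3 ih =>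
    simp only [Finset.mem_union, mem_progression, Finset.mem_singleton]
    refine ⟨?_, ?_, ?_⟩
    · rintro x ((rfl | ⟨i, hi, rfl⟩) | hx) hxe
      · rcases Nat.eq_zero_or_pos p with rfl | hp
        · exact ⟨o', Or.inr hS.mem_ends.1, by omega, by omega⟩
        · exact ⟨x + 4, Or.inl (Or.inr ⟨0, hp, by omega⟩), by omega, by omega⟩
      · by_cases hi' : i + 1 < p
        · exact ⟨_, Or.inl (Or.inr ⟨i + 1, hi', rfl⟩), by omega, by omega⟩
        · exact ⟨o', Or.inr hS.mem_ends.1, by omega, by omega⟩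
      · obtain ⟨y, hy, hy'⟩ := ih.1 x hx hxe
        exact ⟨y, Or.inr hy, hy'⟩
    · left
      rcases Nat.eq_zero_or_pos p with rfl | hp
      · exact Or.inr (by rw [show o + 4 = o' by omega]; exact hS.mem_ends.1)
      · exact Or.inl (Or.inr ⟨0, hp, by omega⟩)
    · obtain ⟨z, hz, hz'⟩ := ih.2.2
      exact ⟨z, Or.inr hz, hz'⟩

theorem append (h : Segment o e S) (y : ℕ) :
    Segment o (e + 4 * y) (S ∪ progression (e + 4) 4 y) := by
  induction y with
  | zero => simpa [progression_zero] using h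
  | succ y ih =>
    have := ih.right _ _ 0 _ (by simp) (by simp)
    rw [progression_zero, Finset.union_empty] at this
    rw [progression_succ, ← Finset.union_assoc]
    rwa [show e + 4 * (y + 1) = e + 4 * y + 4 + 3 * 0 by ring,
      show e + 4 + 4 * y = e + 4 * y + 4 + 3 * 0 by ring]

theorem prepend (k : ℕ) : ∀ {o : ℕ}, Segment (o + 4 * k) e S → Odd o → 3 < o →
    Segment o e (progression o 4 k ∪ S) := by
  induction k with
  | zero => intro o h _ _; simpa [progression_zero] using h
  | succ k ih =>
    intro o h ho ho3
    have h1 : Segment (o + 4) e (progression (o + 4) 4 k ∪ S) :=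
      ih (by rwa [show o + 4 + 4 * k = o + 4 * (k + 1) by ring]) (by grind) (by omega)
    have := h1.left o _ _ 0 _ rfl ho ho3 (by simp) (by simp)
    rwa [progression_zero, Finset.union_empty, ← Finset.union_assoc,
      ← progression_succ_left] at this

theorem append_run (h : Segment o e S) {p y : ℕ} (hp : Even p) (h3 : 0 < p → ¬ 3 ∣ e)
    (hy : 0 < y) :
    Segment o (e + 3 * p + 4 * y) (S ∪ progression (e + 3) 3 p ∪ progression (e + 3 * p + 4) 4 y) := by
  obtain ⟨y, rfl⟩ : ∃ z, y = z + 1 := ⟨y - 1, by omega⟩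
  have := (h.right _ _ p _ hp h3).append y
  rw [Finset.union_assoc, show e + 4 + 3 * p + 4 = e + 3 * p + 4 + 4 by ring,
    show e + 4 + 3 * p = e + 3 * p + 4 by ring, ← progression_succ_left] at this
  convert this using 1
  ring

theorem prepend_run {o' p k : ℕ} (h : Segment o' e S) (ho' : o' = o + 4 * k + 4 + 3 * p)
    (ho : Odd o) (ho3 : 3 < o) (hp : Even p) (h3 : 0 < p → ¬ 3 ∣ o') :
    Segment o e (progression o 4 (k + 1) ∪ progression (o + 4 * k + 4) 3 p ∪ S) := by
  have h1 := (h.left (o + 4 * k) _ _ p _ ho' (by grind) (by omega) hp h3).prepend k ho ho3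
  rwa [progression_succ, Finset.union_assoc, Finset.union_assoc, ← Finset.union_assoc {_}]

end Segment

/-- Allowing `p = 0` in `Segment` turns each progression of difference 4 into repeated steps `right`
or `left`, so that the four rules become three. -/
theorem UpperMinimal.exists_segment {S : Finset ℕ} (h : UpperMinimal S) :
    ∃ o e, Segment o e S := by
  induction h with
  | primitive_one o x y ho ho3 =>
    have h1 := ((Segment.base (o + 4 * x) 0 (by grind) (by omega) (by simp) (by simp)).append
      y).prepend x ho ho3
    refine ⟨_, _, Eq.subst (motive := Segment _ _) ?_ h1⟩
    rw [progression_zero, progression_succ, progression_succ_left (_ + 5)]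
    simp only [mul_zero, add_zero, Finset.union_empty, Finset.union_assoc]
  | primitive_two o x p y ho ho3 h3 hp hpe hy =>
    obtain ⟨y, rfl⟩ : ∃ z, y = z + 1 := ⟨y - 1, by omega⟩
    have h1 := ((Segment.base (o + 4 * x) p (by grind) (by omega) hpe (fun _ => h3)).append
      y).prepend x ho ho3
    refine ⟨_, _, Eq.subst (motive := Segment _ _) ?_ h1⟩
    rw [progression_succ, progression_succ_left (_ + 4),
      show o + 4 * x + 1 + 3 * p + 4 = o + 4 * x + 5 + 3 * p by ring,
      show o + 4 * x + 1 + 3 = o + 4 * x + 4 by ring]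
    simp only [Finset.union_assoc]
  | suffix S e p y hS hmax he h3 hp hpe hy ih =>
    obtain ⟨o, e', h⟩ := ih
    obtain rfl := h.isGreatest.unique hmax
    exact ⟨_, _, h.append_run hpe (fun _ => h3) hy⟩
  | _ S o k p hS hmin h3 ho ho3 hp hpe ih =>
    obtain ⟨o', e, h⟩ := ih
    obtain rfl := h.isLeast.unique hmin
    exact ⟨_, _, h.prepend_run (by ring) ho ho3 hpe (fun _ => h3)⟩

theorem isGreatest_union {A B : Finset ℕ} {e : ℕ} (he : e ∈ B) (hA : ∀ x ∈ A, x ≤ e)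
    (hB : ∀ x ∈ B, x ≤ e) : IsGreatest ((A ∪ B : Finset ℕ) : Set ℕ) e :=
  ⟨by simp [he], fun x hx => by
    rcases Finset.mem_union.1 (Finset.mem_coe.1 hx) with h | h
    · exact hA x h
    · exact hB x h⟩

theorem isLeast_union {A B : Finset ℕ} {e : ℕ} (he : e ∈ A) (hA : ∀ x ∈ A, e ≤ x)
    (hB : ∀ x ∈ B, e ≤ x) : IsLeast ((A ∪ B : Finset ℕ) : Set ℕ) e :=
  ⟨by simp [he], fun x hx => by
    rcases Finset.mem_union.1 (Finset.mem_coe.1 hx) with h | h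
    · exact hA x h
    · exact hB x h⟩

namespace UpperMinimal

/-- Lengthening the final progression of even parts. -/
theorem snoc {S : Finset ℕ} (h : UpperMinimal S) {e : ℕ} (he : IsGreatest (S : Set ℕ) e) :
    UpperMinimal (S ∪ {e + 4}) := by
  induction h with
  | primitive_one o x y ho ho3 =>
    obtain rfl : e = o + 4 * x + 5 + 4 * y := he.unique <| isGreatest_union
      (mem_progression.2 ⟨y, by omega, rfl⟩)
      (fun z hz => by obtain ⟨i, hi, rfl⟩ := mem_progression.1 hz; omega)
      (fun z hz => by obtain ⟨i, hi, rfl⟩ := mem_progression.1 hz; omega)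
    have := primitive_one o x (y + 1) ho ho3
    rwa [progression_succ _ _ (y + 1), ← Finset.union_assoc,
      show o + 4 * x + 5 + 4 * (y + 1) = o + 4 * x + 5 + 4 * y + 4 by ring] at this
  | primitive_two o x p y ho ho3 h3 hp hpe hy =>
    obtain rfl : e = o + 4 * x + 1 + 3 * p + 4 * y := he.unique <| isGreatest_union
      (mem_progression.2 ⟨y - 1, by omega, by omega⟩)
      (fun z hz => by
        rcases Finset.mem_union.1 hz with hz | hz <;>
        · obtain ⟨i, hi, rfl⟩ := mem_progression.1 hz
          omega)
      (fun z hz => by obtain ⟨i, hi, rfl⟩ := mem_progression.1 hz; omega)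
    have := primitive_two o x p (y + 1) ho ho3 h3 hp hpe (by omega)
    rwa [progression_succ _ _ y, ← Finset.union_assoc,
      show o + 4 * x + 1 + 3 * p + 4 + 4 * y = o + 4 * x + 1 + 3 * p + 4 * y + 4 by ring] at this
  | suffix S e' p y hS hmax he' h3 hp hpe hy ih =>
    obtain rfl : e = e' + 3 * p + 4 * y := he.unique <| isGreatest_union
      (mem_progression.2 ⟨y - 1, by omega, by omega⟩)
      (fun z hz => by
        rcases Finset.mem_union.1 hz with hz | hz
        · have : z ≤ e' := hmax.2 hz
          omega
        · obtain ⟨i, hi, rfl⟩ := mem_progression.1 hz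
          omega)
      (fun z hz => by obtain ⟨i, hi, rfl⟩ := mem_progression.1 hz; omega)
    have := suffix S e' p (y + 1) hS hmax he' h3 hp hpe (by omega)
    rwa [progression_succ _ _ y, ← Finset.union_assoc,
      show e' + 3 * p + 4 + 4 * y = e' + 3 * p + 4 * y + 4 by ring] at this
  | _ S o k p hS hmin h3 ho ho3 hp hpe ih =>
    have hlt : ∀ z ∈ progression o 4 (k + 1) ∪ progression (o + 4 * k + 3 + 1) 3 p,
        z < o + 4 * k + 3 * (p + 1) + 1 := fun z hz => by
      rcases Finset.mem_union.1 hz with hz | hz <;>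
      · obtain ⟨i, hi, rfl⟩ := mem_progression.1 hz
        omega
    have hle : o + 4 * k + 3 * (p + 1) + 1 ≤ e := he.2 (by simpa using Or.inr (Or.inr hmin.1))
    have heS : e ∈ S := by
      rcases Finset.mem_union.1 (Finset.mem_coe.1 he.1) with h | h
      · have := hlt e h; omega
      · exact h
    -- The prefix does not touch the largest part: the new part is adjoined to `S`, and the prefix
    -- rule is applied afterwards.
    have := ih ⟨heS, fun z hz => he.2 (by simpa using Or.inr (Or.inr hz))⟩
    rw [Finset.union_assoc]
    refine UpperMinimal.prefix _ o k p this (isLeast_union hmin.1 (fun z hz => hmin.2 hz) ?_) h3 ho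
      ho3 hp hpe
    intro z hz
    rw [Finset.mem_singleton] at hz
    omega

/-- Lengthening the initial progression of odd parts. -/
theorem cons {S : Finset ℕ} (h : UpperMinimal S) {o : ℕ} (he : IsLeast (S : Set ℕ) (o + 4))
    (ho : 3 < o) : UpperMinimal ({o} ∪ S) := by
  induction h with
  | primitive_one o' x y ho' ho3' =>
    obtain rfl : o + 4 = o' := he.unique <| isLeast_union
      (mem_progression.2 ⟨0, by omega, rfl⟩)
      (fun z hz => by obtain ⟨i, hi, rfl⟩ := mem_progression.1 hz; omega)
      (fun z hz => by obtain ⟨i, hi, rfl⟩ := mem_progression.1 hz; omega)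
    have := primitive_one o (x + 1) y (by grind) ho
    rwa [progression_succ_left, Finset.union_assoc,
      show o + 4 * (x + 1) + 5 = o + 4 + 4 * x + 5 by ring] at this
  | primitive_two o' x p y ho' ho3' h3 hp hpe hy =>
    obtain rfl : o + 4 = o' := by
      rw [Finset.union_assoc] at he
      refine he.unique <| isLeast_union (mem_progression.2 ⟨0, by omega, rfl⟩)
        (fun z hz => by obtain ⟨i, hi, rfl⟩ := mem_progression.1 hz; omega)
        (fun z hz => by
          rcases Finset.mem_union.1 hz with hz | hz <;>
          · obtain ⟨i, hi, rfl⟩ := mem_progression.1 hz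
            omega)
    rw [show o + 4 + 4 * x + 1 = o + 4 * (x + 1) + 1 by ring] at h3 ⊢
    have := primitive_two o (x + 1) p y (by grind) ho h3 hp hpe hy
    rwa [progression_succ_left, Finset.union_assoc {o}, Finset.union_assoc {o}] at this
  | suffix S e p y hS hmax he' h3 hp hpe hy ih =>
    have hgt : ∀ z ∈ progression (e + 3) 3 p ∪ progression (e + 3 * p + 4) 4 y, e < z :=
        fun z hz => by
      rcases Finset.mem_union.1 hz with hz | hz <;>
      · obtain ⟨i, hi, rfl⟩ := mem_progression.1 hz
        omega
    rw [Finset.union_assoc] at he ⊢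
    have hle : o + 4 ≤ e := he.2 (by simpa using Or.inl hmax.1)
    have heS : o + 4 ∈ S := by
      rcases Finset.mem_union.1 (Finset.mem_coe.1 he.1) with h | h
      · exact h
      · have := hgt _ h; omega
    have := ih ⟨heS, fun z hz => he.2 (by simpa using Or.inl hz)⟩
    rw [← Finset.union_assoc, ← Finset.union_assoc]
    refine UpperMinimal.suffix _ e p y this (isGreatest_union hmax.1 ?_ (fun z hz => hmax.2 hz)) he'
      h3 hp hpe hy
    intro z hz
    rw [Finset.mem_singleton] at hz
    omega
  | _ S o' k p hS hmin h3 ho' ho3' hp hpe ih =>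
    obtain rfl : o + 4 = o' := by
      rw [Finset.union_assoc] at he
      refine he.unique <| isLeast_union (mem_progression.2 ⟨0, by omega, rfl⟩)
        (fun z hz => by obtain ⟨i, hi, rfl⟩ := mem_progression.1 hz; omega)
        (fun z hz => by
          rcases Finset.mem_union.1 hz with hz | hz
          · obtain ⟨i, hi, rfl⟩ := mem_progression.1 hz
            omega
          · have := hmin.2 hz
            omega)
    rw [show o + 4 + 4 * k = o + 4 * (k + 1) by ring] at h3 hmin ⊢
    have := UpperMinimal.prefix S o (k + 1) p hS hmin h3 (by grind) ho hp hpe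
    rwa [progression_succ_left, Finset.union_assoc {o}, Finset.union_assoc {o}] at this

end UpperMinimal

/-- Steps with `p > 0` are instances of the original rules; steps with `p = 0` are supplied by
`snoc` and `cons`. -/
theorem Segment.upperMinimal {o e : ℕ} {S : Finset ℕ} (h : Segment o e S) : UpperMinimal S := by
  induction h with
  | base o p ho ho3 hp h3 =>
    rcases Nat.eq_zero_or_pos p with rfl | hp0
    · have := UpperMinimal.primitive_one o 0 0 ho ho3
      simpa [progression_zero, progression_one] using this
    · have := UpperMinimal.primitive_two o 0 p 1 ho ho3 (h3 hp0) hp0 hp one_pos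
      rw [progression_one, progression_one] at this
      convert this using 3
      ring
  | right o e p S hS hp h3 ih =>
    rcases Nat.eq_zero_or_pos p with rfl | hp0
    · simpa [progression_zero] using ih.snoc hS.isGreatest
    · have := UpperMinimal.suffix S e p 1 ih hS.isGreatest hS.odd_even.2.1 (h3 hp0) hp0 hp one_pos
      rw [progression_one] at this
      convert this using 3
      ring
  | left o o' e p S hS he ho ho3 hp h3 ih =>
    rcases Nat.eq_zero_or_pos p with rfl | hp0
    · have := ih.cons (o := o) (by simpa [he] using hS.isLeast) ho3
      simpa [progression_zero] using this
    · have e1 : o' = o + 4 * 0 + 3 * (p + 1) + 1 := by omega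
      have := UpperMinimal.prefix S o 0 p ih (e1 ▸ hS.isLeast) (e1 ▸ h3 hp0) ho ho3 hp0 hp
      rwa [progression_one] at this

/-! ### Upper minimal segments inside a Schur partition -/

theorem paired_eq_of_notMem {π : Finset ℕ} (h4 : 4 ∉ π) {x : ℕ} :
    x ∈ paired π ↔ UpperPaired π x := by
  rw [mem_paired, Finset.erase_eq_of_notMem h4]

theorem IsSchur.ne_of_mem {π : Finset ℕ} (hS : IsSchur π) {x y : ℕ} (hx : x ∈ π) (hy : y ∈ π)
    (h1 : x < y) (h2 : y < x + 3) : False := by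
  have := (hS.2 x hx y hy h1).1
  omega

namespace Segment

variable {π S : Finset ℕ} {o e : ℕ}

/-- Neighbours in a segment are at most 5 apart, and a further part between them would need a
distance of 6. -/
theorem mem_of_between (h : Segment o e S) (hS : IsSchur π) (hsub : S ⊆ π) {z : ℕ} (hz : z ∈ π)
    (h1 : o ≤ z) (h2 : z ≤ e) : z ∈ S := by
  obtain ⟨x, hx, hmax⟩ := (S.filter (· ≤ z)).exists_max_image id
    ⟨o, Finset.mem_filter.2 ⟨h.mem_ends.1, h1⟩⟩
  rw [Finset.mem_filter] at hx
  rcases Nat.eq_or_lt_of_le hx.2 with rfl | hlt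
  · exact hx.1
  · exfalso
    obtain ⟨y, hy, hxy, hyx⟩ := h.gaps.1 x hx.1 (by omega)
    have hzy : z < y := by
      by_contra hc
      have := hmax y (Finset.mem_filter.2 ⟨hy, by omega⟩)
      simp only [id] at this
      omega
    have := (hS.2 x (hsub hx.1) z hz hlt).1
    have := (hS.2 z hz y (hsub hy) hzy).1
    omega

/-- Every singleton in a segment, the last one excepted, is linked to another one. -/
theorem exists_link (h : Segment o e S) (hS : IsSchur π) (h4 : 4 ∉ π) (hsub : S ⊆ π)
    (ho : o ∉ paired π) (he : e ∉ paired π) :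
    ∀ x ∈ S, x ∉ paired π → x < e → ∃ y ∈ S, y ∉ paired π ∧ Link (paired π) (key x) (key y) := by
  induction h with
  | base o p ho1 ho3 hp h3 =>
    rw [Finset.union_subset_iff, Finset.union_subset_iff, Finset.singleton_subset_iff,
      Finset.singleton_subset_iff] at hsub
    obtain ⟨⟨hoπ, hrun⟩, heπ⟩ := hsub
    have hpair : ∀ i < p, o + 4 + 3 * i ∈ paired π := by
      intro i hi
      have hr : IsMaxRun π (o + 4) p := by
        refine ⟨by omega, fun i hi => hrun (mem_progression.2 ⟨i, hi, rfl⟩), fun b hb e => ?_,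
          fun hc => ?_⟩
        · exact hS.ne_of_mem hoπ hb (by omega) (by omega)
        · exact hS.ne_of_mem hc heπ (by omega) (by omega)
      exact (paired_eq_of_notMem h4).2 ((upperPaired_iff hr hi).2 ⟨by grind, by grind, by grind⟩)
    intro x hx hx' hxe
    simp only [Finset.mem_union, mem_progression, Finset.mem_singleton] at hx
    rcases hx with (rfl | ⟨i, hi, rfl⟩) | rfl
    · refine ⟨x + 5 + 3 * p, by simp, he, ?_⟩
      rw [key_of_odd ho1, key_of_even (by grind)]
      exact ⟨ho3, p, hp, hpair, by omega⟩
    · exact absurd (hpair i hi) hx'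
    · omega
  | right o e p S hseg hp h3 ih =>
    rw [Finset.union_subset_iff, Finset.union_subset_iff, Finset.singleton_subset_iff] at hsub
    obtain ⟨⟨hSπ, hrun⟩, heπ⟩ := hsub
    have heven := hseg.odd_even
    have heS := hseg.mem_ends.2.1
    have hr : IsMaxRun π e (p + 1) := by
      refine ⟨by omega, fun i hi => ?_, fun b hb hbe => ?_, fun hc => ?_⟩
      · rcases i with _ | i
        · exact hSπ heS
        · exact hrun (mem_progression.2 ⟨i, by omega, by ring⟩)
      · obtain ⟨z, hz, hz'⟩ := hseg.gaps.2.2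
        exact hS.ne_of_mem (hSπ hz) hb (by omega) (by omega)
      · exact hS.ne_of_mem hc heπ (by omega) (by omega)
    have hpair : ∀ i < p, e + 3 + 3 * i ∈ paired π := by
      intro i hi
      rw [paired_eq_of_notMem h4, show e + 3 + 3 * i = e + 3 * (i + 1) by ring,
        upperPaired_iff hr (by omega)]
      exact ⟨by omega, by grind, by omega⟩
    -- The old end `e` is interior now. It is still a singleton, as the even head of a run of odd
    -- length `p + 1`, so the induction hypothesis applies.
    have hsing : e ∉ paired π := by
      rw [paired_eq_of_notMem h4]
      intro hc
      exact ((upperPaired_iff hr (i := 0) (by omega)).1 hc).2.2 ⟨by grind, heven.2.1, rfl⟩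
    intro x hx hx' hxe
    simp only [Finset.mem_union, mem_progression, Finset.mem_singleton] at hx ⊢
    rcases hx with (hx | ⟨i, hi, rfl⟩) | rfl
    · rcases Nat.eq_or_lt_of_le (hseg.mem_ends.2.2 x hx).2 with rfl | hlt
      · refine ⟨x + 4 + 3 * p, by simp, he, ?_⟩
        rw [key_of_even heven.2.1, key_of_even (by grind)]
        refine ⟨by omega, p, hp, fun i hi => ?_, by omega⟩
        rw [show x - 1 + 4 + 3 * i = x + 3 + 3 * i by omega]
        exact hpair i hi
      · obtain ⟨y, hy, hy'⟩ := ih hSπ ho hsing x hx hx' hlt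
        exact ⟨y, Or.inl (Or.inl hy), hy'⟩
    · exact absurd (hpair i hi) hx'
    · omega
  | left o o' e p S hseg ho' ho1 ho3 hp h3 ih =>
    rw [Finset.union_subset_iff, Finset.union_subset_iff, Finset.singleton_subset_iff] at hsub
    obtain ⟨⟨hoπ, hrun⟩, hSπ⟩ := hsub
    have hodd := hseg.odd_even
    have hoS := hseg.mem_ends.1
    have hr : IsMaxRun π (o + 4) (p + 1) := by
      refine ⟨by omega, fun i hi => ?_, fun b hb hbe => ?_, fun hc => ?_⟩
      · rcases Nat.lt_or_ge i p with h | h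
        · exact hrun (mem_progression.2 ⟨i, h, rfl⟩)
        · obtain rfl : i = p := by omega
          exact hSπ (ho' ▸ hoS)
      · exact hS.ne_of_mem hoπ hb (by omega) (by omega)
      · rcases hseg.gaps.2.1 with hz | hz <;>
        exact hS.ne_of_mem hc (hSπ hz) (by omega) (by omega)
    have hpair : ∀ i < p, o + 4 + 3 * i ∈ paired π := by
      intro i hi
      rw [paired_eq_of_notMem h4, upperPaired_iff hr (by omega)]
      exact ⟨by omega, by omega, by grind⟩
    have hsing : o' ∉ paired π := by
      rw [paired_eq_of_notMem h4, ho']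
      intro hc
      exact ((upperPaired_iff hr (i := p) (by omega)).1 hc).2.1 ⟨by grind, by grind, rfl⟩
    intro x hx hx' hxe
    simp only [Finset.mem_union, mem_progression, Finset.mem_singleton] at hx ⊢
    rcases hx with (rfl | ⟨i, hi, rfl⟩) | hx
    · refine ⟨o', Or.inr hoS, hsing, ?_⟩
      rw [key_of_odd ho1, key_of_odd hodd.1]
      exact ⟨ho3, p, hp, hpair, ho'⟩
    · exact absurd (hpair i hi) hx'
    · obtain ⟨y, hy, hy'⟩ := ih hSπ hsing he x hx hx' hxe
      exact ⟨y, Or.inr hy, hy'⟩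

theorem sameCluster (h : Segment o e S) (hS : IsSchur π) (h4 : 4 ∉ π) (hsub : S ⊆ π)
    (ho : o ∉ paired π) (he : e ∉ paired π) :
    SameCluster (paired π) (keys π) (key o) (key e) := by
  have h1 := h.odd_even
  rw [key_of_odd h1.1, key_of_even h1.2.1]
  intro k hk hk1 hk2
  obtain ⟨x, hx, hx', rfl⟩ := mem_keys.1 hk
  have := key_le x
  have := le_key x
  obtain ⟨y, hy, hy', hl⟩ := h.exists_link hS h4 hsub ho he x
    (h.mem_of_between hS hsub hx (by omega) (by omega)) hx' (by omega)
  exact ⟨key y, mem_keys.2 ⟨y, hsub hy, hy', rfl⟩, hl⟩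

end Segment

/-- The members of a Schur partition between two parts joined by a progression of difference `3`
are those of the progression. -/
theorem IsSchur.exists_eq {π : Finset ℕ} (hS : IsSchur π) {x b p z w : ℕ} (hx : x ∈ π)
    (hb : b ≤ x + 4) (hp : ∀ i < p, b + 3 * i ∈ π) (hz : z ∈ π) (hzb : z ≤ b + 1 + 3 * p)
    (hw : w ∈ π) (h1 : x < w) (h2 : w < z) : ∃ i < p, b + 3 * i = w := by
  by_contra! hne
  -- A part off the progression gets past every term with a loss of at most 1, and then comes closer
  -- than 3 to `z`.
  have key : ∀ i ≤ p, b + 3 * i ≤ w + 1 := by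
    intro i
    induction i with
    | zero =>
      intro _
      have := (hS.2 x hx w hw h1).1
      omega
    | succ i ih =>
      intro hi
      have h3 := ih (by omega)
      have h4 := hne i (by omega)
      rcases Nat.lt_or_gt_of_ne h4 with h5 | h5
      · have := (hS.2 _ (hp i (by omega)) w hw h5).1
        omega
      · have := (hS.2 w hw _ (hp i (by omega)) h5).1
        omega
  have := key p le_rfl
  have := (hS.2 w hw z hz h2).1
  omega

/-- Singletons are peeled off one at a time. If the second singleton is odd, `x` is removed,
matching `left`; if it is even and not `y`, then by monotonicity all later ones are even and `y` is
removed, matching `right`; if it is `y`, the segment is a `base`. -/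
theorem exists_segment_of_sameCluster {π : Finset ℕ} (hS : IsSchur π) (h3 : ∀ x ∈ π, 3 ≤ x)
    {x y : ℕ} (hx : x ∈ π) (hx' : x ∉ paired π) (hxo : Odd x) (hy : y ∈ π) (hy' : y ∉ paired π)
    (hye : Even y) (hxy : x < y) (hc : SameCluster (paired π) (keys π) (key x) (key y)) :
    Segment x y (π.filter fun z => x ≤ z ∧ z ≤ y) := by
  have hsig := isSigned_of_isSchur hS h3
  have hsub := paired_subset π
  induction hn : y - x using Nat.strong_induction_on generalizing x y with
  | _ n ih =>
    subst hn
    rw [key_of_odd hxo, key_of_even hye] at hc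
    have hxK : x ∈ keys π := mem_keys.2 ⟨x, hx, hx', key_of_odd hxo⟩
    have hyK : y - 1 ∈ keys π := mem_keys.2 ⟨y, hy, hy', key_of_even hye⟩
    have hlt : x < y - 1 := by
      by_contra hcon
      exact hS.ne_of_mem hx hy hxy (by omega)
    obtain ⟨k, hk, hl⟩ := hc x hxK (by omega) (by omega)
    have hky := hsig.le_of_link hxK hl hyK hlt
    obtain ⟨hx3, p, hp, hpP, rfl⟩ := hl
    obtain ⟨z, hz, hz', hkz⟩ := mem_keys.1 hk
    rcases Nat.even_or_odd z with hze | hzo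
    · rw [key_of_even hze] at hkz
      rcases Nat.eq_or_lt_of_le hky with heq | hlt'
      · have hyp : y = x + 5 + 3 * p := by omega
        have hb := Segment.base x p hxo hx3 hp fun hp0 => by
          have := hsig.not_dvd _ (hpP 0 hp0)
          omega
        rw [← hyp] at hb
        convert hb using 1
        ext w
        simp only [Finset.mem_filter, Finset.mem_union, mem_progression, Finset.mem_singleton]
        constructor
        · rintro ⟨hw, h1, h2⟩
          rcases Nat.eq_or_lt_of_le h1 with rfl | h1
          · exact Or.inl (Or.inl rfl)
          rcases Nat.eq_or_lt_of_le h2 with rfl | h2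
          · exact Or.inr rfl
          exact Or.inl (Or.inr (hS.exists_eq hx le_rfl (fun i hi => hsub (hpP i hi)) hy (by omega)
            hw h1 h2))
        · rintro ((rfl | ⟨i, hi, rfl⟩) | rfl)
          · exact ⟨hx, by omega, by omega⟩
          · exact ⟨hsub (hpP i hi), by omega, by omega⟩
          · exact ⟨hy, by omega, by omega⟩
      -- The last key before that of `y`: its part `u` is even because the key of `z` is, and it is
      -- linked to the key of `y`.
      · obtain ⟨j, hj, hjmax⟩ := ((keys π).filter (· < y - 1)).exists_max_image id
          ⟨_, Finset.mem_filter.2 ⟨hk, hlt'⟩⟩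
        rw [Finset.mem_filter] at hj
        have hkj : x + 4 + 3 * p ≤ j := hjmax _ (Finset.mem_filter.2 ⟨hk, hlt'⟩)
        obtain ⟨k', hk', hl'⟩ := hc j hj.1 (by omega) (by omega)
        have hk'y := hsig.le_of_link hj.1 hl' hyK hj.2
        have hjk' : j < k' := by obtain ⟨-, q, -, -, rfl⟩ := hl'; omega
        obtain rfl : k' = y - 1 := by
          by_contra hne
          have := hjmax k' (Finset.mem_filter.2 ⟨hk', by omega⟩)
          simp only [id] at this
          omega
        have hzE : x + 4 + 3 * p ∈ evenKeys π := mem_evenKeys.2 ⟨z, hz, hz', hze, by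
          rw [key_of_even hze, hkz]⟩
        have hjE : j ∈ evenKeys π := hsig.mem_of_sameCluster hzE hj.1 hkj fun i hi h1 h2 =>
          hc i hi (by omega) (by omega)
        obtain ⟨u, hu, hu', hue, rfl⟩ := mem_evenKeys.1 hjE
        have hku := key_of_even hue
        have hseg := ih (u - x) (by omega) hx hx' hxo hu hu' hue (by omega) (by
          rw [key_of_odd hxo]
          exact fun i hi h1 h2 => hc i hi (by omega) (by omega)) rfl
        obtain ⟨-, q, hq, hqP, hqe⟩ := hl'
        have hqP' : ∀ i < q, u + 3 + 3 * i ∈ paired π := fun i hi => by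
          convert hqP i hi using 1; omega
        have hb := hseg.right _ _ q _ hq fun hq0 => by
          have := hsig.not_dvd _ (hqP' 0 hq0)
          omega
        have hyq : u + 4 + 3 * q = y := by omega
        rw [hyq] at hb
        convert hb using 1
        ext w
        simp only [Finset.mem_filter, Finset.mem_union, mem_progression, Finset.mem_singleton]
        constructor
        · rintro ⟨hw, h1, h2⟩
          rcases Nat.lt_or_ge u w with h4 | h4
          · rcases Nat.eq_or_lt_of_le h2 with rfl | h2
            · exact Or.inr rfl
            exact Or.inl (Or.inr (hS.exists_eq hu (by omega) (fun i hi => hsub (hqP' i hi)) hy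
              (by omega) hw h4 h2))
          · exact Or.inl (Or.inl ⟨hw, h1, h4⟩)
        · rintro ((⟨hw, h1, h2⟩ | ⟨i, hi, rfl⟩) | rfl)
          · exact ⟨hw, by omega, by omega⟩
          · exact ⟨hsub (hqP' i hi), by omega, by omega⟩
          · exact ⟨hy, by omega, by omega⟩
    · rw [key_of_odd hzo] at hkz
      subst hkz
      have hseg := ih (y - (x + 4 + 3 * p)) (by omega) hz hz' hzo hy hy' hye (by omega) (by
          rw [key_of_odd hzo, key_of_even hye]
          exact fun i hi h1 h2 => hc i hi (by omega) (by omega)) rfl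
      have hb := hseg.left x _ _ p _ rfl hxo hx3 hp fun hp0 => by
          have := hsig.not_dvd _ (hpP 0 hp0)
          omega
      convert hb using 1
      ext w
      simp only [Finset.mem_filter, Finset.mem_union, mem_progression, Finset.mem_singleton]
      constructor
      · rintro ⟨hw, h1, h2⟩
        rcases Nat.eq_or_lt_of_le h1 with rfl | h1
        · exact Or.inl (Or.inl rfl)
        rcases Nat.lt_or_ge w (x + 4 + 3 * p) with h4 | h4
        · exact Or.inl (Or.inr (hS.exists_eq hx le_rfl (fun i hi => hsub (hpP i hi)) hz (by omega)
            hw h1 h4))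
        · exact Or.inr ⟨hw, h4, h2⟩
      · rintro ((rfl | ⟨i, hi, rfl⟩) | ⟨hw, h1, h2⟩)
        · exact ⟨hx, by omega, by omega⟩
        · exact ⟨hsub (hpP i hi), by omega, by omega⟩
        · exact ⟨hw, by omega, by omega⟩

/-! ### The reduction map in terms of clusters -/

section Signed

variable {P K E : Finset ℕ}

theorem IsSigned.paired_iff (h : IsSigned P K E) (h4 : 4 ∉ realize P K E) {x : ℕ} :
    UpperPaired (realize P K E) x ↔ x ∈ P := by
  rw [← h.upperPaired_iff, Finset.erase_eq_of_notMem h4]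

theorem IsSigned.oddSingletons_eq (h : IsSigned P K E) (h4 : 4 ∉ realize P K E) :
    oddSingletons (realize P K E) = K \ E := by
  ext x
  simp only [oddSingletons, Finset.mem_filter, h.paired_iff h4, Finset.mem_sdiff]
  constructor
  · rintro ⟨hx, ho, hP⟩
    obtain ⟨k, hk, rfl⟩ := h.mem_realize_sdiff.1 ⟨hx, hP⟩
    have hkE : k ∉ E := fun hkE =>
      (Nat.not_even_iff_odd.2 ho) ((even_place (h.key_odd k hk)).2 hkE)
    rw [place_of_notMem hkE]
    exact ⟨hk, hkE⟩
  · rintro ⟨hk, hkE⟩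
    have := h.mem_realize_sdiff.2 ⟨x, hk, rfl⟩
    rw [place_of_notMem hkE] at this
    exact ⟨this.1, h.key_odd x hk, this.2⟩

theorem IsSigned.evenSingletons_eq (h : IsSigned P K E) (h4 : 4 ∉ realize P K E) :
    evenSingletons (realize P K E) = E.image (· + 1) := by
  ext x
  simp only [evenSingletons, Finset.mem_filter, h.paired_iff h4, Finset.mem_image]
  constructor
  · rintro ⟨hx, ho, hP⟩
    obtain ⟨k, hk, rfl⟩ := h.mem_realize_sdiff.1 ⟨hx, hP⟩
    have hkE := (even_place (h.key_odd k hk)).1 ho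
    exact ⟨k, hkE, (place_of_mem hkE).symm⟩
  · rintro ⟨k, hkE, rfl⟩
    have := h.mem_realize_sdiff.2 ⟨k, h.subset hkE, rfl⟩
    rw [place_of_mem hkE] at this
    have ho := h.key_odd k (h.subset hkE)
    exact ⟨this.1, by grind, this.2⟩

/-- Together with `card_filter_lt_of_mem` this converts the counts in `rhoPart`, taken among
singletons of one parity, into the rank in the whole cluster. -/
theorem card_filter_lt_of_notMem {C U : Finset ℕ} (hU : ∀ j ∈ U, ∀ k ∈ C, j ≤ k → k ∈ U) {k : ℕ}
    (hk : k ∈ C) (hkU : k ∉ U) :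
    (C \ U).card = (C.filter (· < k)).card + 1 + ((C \ U).filter (k < ·)).card := by
  have h1 := Finset.card_filter_add_card_filter_not (s := C \ U) (· < k)
  have h2 : (C \ U).filter (· < k) = C.filter (· < k) := by
    ext x
    simp only [Finset.mem_filter, Finset.mem_sdiff]
    exact ⟨fun h => ⟨h.1.1, h.2⟩, fun h => ⟨⟨h.1, fun hx => hkU (hU x hx k hk h.2.le)⟩, h.2⟩⟩
  have h3 : (C \ U).filter (fun x => ¬ x < k) = insert k ((C \ U).filter (k < ·)) := by
    ext x
    simp only [Finset.mem_filter, Finset.mem_sdiff, Finset.mem_insert]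
    constructor
    · rintro ⟨h, h'⟩
      rcases Nat.eq_or_lt_of_le (not_lt.1 h') with rfl | h''
      · exact Or.inl rfl
      · exact Or.inr ⟨h, h''⟩
    · rintro (rfl | ⟨h, h'⟩)
      · exact ⟨⟨hk, hkU⟩, by omega⟩
      · exact ⟨h, by omega⟩
  rw [h2, h3, Finset.card_insert_of_notMem (by simp)] at h1
  omega

theorem card_filter_lt_of_mem {C U : Finset ℕ} (hUC : U ⊆ C)
    (hU : ∀ j ∈ U, ∀ k ∈ C, j ≤ k → k ∈ U) {k : ℕ} (hkU : k ∈ U) :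
    (C.filter (· < k)).card = (C \ U).card + (U.filter (· < k)).card := by
  rw [← Finset.card_union_of_disjoint]
  · congr 1
    ext x
    simp only [Finset.mem_filter, Finset.mem_union, Finset.mem_sdiff]
    constructor
    · rintro ⟨h, h'⟩
      by_cases hx : x ∈ U
      · exact Or.inr ⟨hx, h'⟩
      · exact Or.inl ⟨h, hx⟩
    · rintro (⟨h, h'⟩ | ⟨h, h'⟩)
      · refine ⟨h, ?_⟩
        by_contra hc
        exact h' (hU k hkU x h (by omega))
      · exact ⟨hUC h, h'⟩
  · rw [Finset.disjoint_left]
    intro x hx hx'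
    exact (Finset.mem_sdiff.1 hx).2 (Finset.mem_filter.1 hx').1

/-- The effect of `ρ` on a partition with a single cluster. -/
theorem IsSigned.rhoPart_place (h : IsSigned P K E) (h4 : 4 ∉ realize P K E)
    (hU : ∀ j ∈ E, ∀ k ∈ K, j ≤ k → k ∈ E) {k : ℕ} (hk : k ∈ K) :
    rhoPart (realize P K E) (place E k) =
      (if E.card ≤ (K.filter (· < k)).card then k + 1 else k) - 3 := by
  have hcard : (E.image (· + 1)).card = E.card :=
    Finset.card_image_of_injective _ (add_left_injective 1)
  have hodd := h.key_odd k hk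
  simp only [rhoPart, h.oddSingletons_eq h4, h.evenSingletons_eq h4, hcard]
  -- Let `r` be the rank of `k`. An even singleton has `r - ω'` even ones below it, fewer than `ε' -
  -- ω'` exactly if `r < ε'`; an odd one has `ω' - 1 - r` odd ones above it, fewer than `ω' - ε'`
  -- exactly if `ε' ≤ r`. Lowering `k + 1` by 4 or `k` by 2 means changing the sign and lowering by
  -- 3.
  by_cases hkE : k ∈ E
  · have h1 := card_filter_lt_of_mem h.subset hU hkE
    have h2 : ((E.image (· + 1)).filter (· < k + 1)).card = (E.filter (· < k)).card := by
      rw [Finset.filter_image, Finset.card_image_of_injective _ (add_left_injective 1)]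
      simp
    rw [place_of_mem hkE, if_neg, h2]
    · have h3 : k + 1 ∈ E.image (· + 1) := Finset.mem_image_of_mem _ hkE
      simp only [h3, true_and]
      split_ifs <;> omega
    · rintro ⟨hc, -⟩
      have := h.key_odd _ (Finset.mem_sdiff.1 hc).1
      grind
  · have h1 := card_filter_lt_of_notMem hU hk hkE
    have h3 : k ∈ K \ E := Finset.mem_sdiff.2 ⟨hk, hkE⟩
    have h4 : k ∉ E.image (· + 1) := by
      intro hc
      obtain ⟨j, hj, e⟩ := Finset.mem_image.1 hc
      have := h.key_odd _ (h.subset hj)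
      grind
    rw [place_of_notMem hkE]
    simp only [h3, h4, true_and, false_and, if_false]
    split_ifs <;> omega

theorem IsSigned.rhoPart_of_mem (h : IsSigned P K E) (h4 : 4 ∉ realize P K E) {x : ℕ}
    (hx : x ∈ P) : rhoPart (realize P K E) x = x - 3 := by
  rw [rhoPart, if_neg, if_neg]
  · simp [evenSingletons, h.paired_iff h4, hx]
  · simp [oddSingletons, h.paired_iff h4, hx]

end Signed

/-! ### Clusters with both signs span the longest upper minimal segments -/

section Cluster

variable {π : Finset ℕ}

theorem IsUpperSegment.exists_ends (hS : IsSchur π) (h4 : 4 ∉ π) {S : Finset ℕ}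
    (h : IsUpperSegment π S) :
    ∃ o e, Segment o e S ∧ o ∉ paired π ∧ e ∉ paired π ∧
      SameCluster (paired π) (keys π) (key o) (key e) := by
  obtain ⟨hsub, hU, hends⟩ := h
  obtain ⟨o, e, hseg⟩ := hU.exists_segment
  have ho : o ∉ paired π := fun hc =>
    hends o (Or.inl hseg.isLeast) ((paired_eq_of_notMem h4).1 hc)
  have he : e ∉ paired π := fun hc =>
    hends e (Or.inr hseg.isGreatest) ((paired_eq_of_notMem h4).1 hc)
  exact ⟨o, e, hseg, ho, he, hseg.sameCluster hS h4 hsub ho he⟩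

/-- `o` and `e` are the smallest and the largest part of the cluster of `k`, and these are odd and
even. -/
structure IsMixedEnds (π : Finset ℕ) (k o e : ℕ) : Prop where
  odd : Odd o
  even : Even e
  mem_left : o ∈ π
  mem_right : e ∈ π
  left_notMem : o ∉ paired π
  right_notMem : e ∉ paired π
  left_mem : o ∈ cluster (paired π) (keys π) k
  right_mem : e - 1 ∈ cluster (paired π) (keys π) k
  le : ∀ i ∈ cluster (paired π) (keys π) k, o ≤ i ∧ i ≤ e - 1

/-- Signs increase along a cluster, so if both occur, the lowest singleton is odd and the highest
even, as a segment demands. -/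
theorem exists_isMixedEnds (hS : IsSchur π) (h3 : ∀ x ∈ π, 3 ≤ x) {k i j : ℕ}
    (hi : i ∈ cluster (paired π) (keys π) k) (hiE : i ∉ evenKeys π)
    (hj : j ∈ cluster (paired π) (keys π) k) (hjE : j ∈ evenKeys π) :
    ∃ o e, IsMixedEnds π k o e := by
  have hsig := isSigned_of_isSchur hS h3
  obtain ⟨lo, hlo, hmin⟩ := (cluster (paired π) (keys π) k).exists_min_image id ⟨i, hi⟩
  obtain ⟨hi', hhi, hmax⟩ := (cluster (paired π) (keys π) k).exists_max_image id ⟨i, hi⟩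
  have hsame : ∀ a ∈ cluster (paired π) (keys π) k, ∀ b ∈ cluster (paired π) (keys π) k,
      SameCluster (paired π) (keys π) a b := fun a ha b hb =>
    (mem_cluster.1 ha).2.symm.trans (mem_cluster.1 hb).2
  have hloE : lo ∉ evenKeys π := fun hc =>
    hiE (hsig.mem_of_sameCluster hc (cluster_subset _ _ _ hi) (hmin i hi) (hsame _ hlo _ hi))
  have hhiE : hi' ∈ evenKeys π :=
    hsig.mem_of_sameCluster hjE (cluster_subset _ _ _ hhi) (hmax j hj) (hsame _ hj _ hhi)
  obtain ⟨o, ho, ho', rfl⟩ := mem_keys.1 (cluster_subset _ _ _ hlo)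
  obtain ⟨e, he, he', hee, rfl⟩ := mem_evenKeys.1 hhiE
  have hoo : Odd o := by
    by_contra hc
    exact hloE (mem_evenKeys.2 ⟨o, ho, ho', Nat.not_odd_iff_even.1 hc, rfl⟩)
  rw [key_of_odd hoo] at hlo hmin
  rw [key_of_even hee] at hhi hmax
  exact ⟨o, e, hoo, hee, ho, he, ho', he', hlo, hhi, fun n hn => ⟨hmin n hn, hmax n hn⟩⟩

/-- The parts of `π` from `o` to `e`. -/
def between (π : Finset ℕ) (o e : ℕ) : Finset ℕ := π.filter fun z => o ≤ z ∧ z ≤ e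

namespace IsMixedEnds

variable {k o e : ℕ}

theorem lt (h : IsMixedEnds π k o e) : o < e := by
  have := (h.le _ h.left_mem).2
  have := h.odd
  have := h.even
  grind

theorem mem_cluster (h : IsMixedEnds π k o e) {i : ℕ} (hi : i ∈ keys π) (h1 : o ≤ i)
    (h2 : i ≤ e - 1) : i ∈ cluster (paired π) (keys π) k := by
  have ho := SchurReduction.mem_cluster.1 h.left_mem
  have he := SchurReduction.mem_cluster.1 h.right_mem
  exact SchurReduction.mem_cluster.2 ⟨hi, ho.2.trans ((ho.2.symm.trans he.2).of_le h1 h2)⟩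

theorem segment (hS : IsSchur π) (h3 : ∀ x ∈ π, 3 ≤ x) (h : IsMixedEnds π k o e) :
    Segment o e (between π o e) := by
  refine exists_segment_of_sameCluster hS h3 h.mem_left h.left_notMem h.odd h.mem_right
    h.right_notMem h.even h.lt ?_
  rw [key_of_odd h.odd, key_of_even h.even]
  exact (SchurReduction.mem_cluster.1 h.left_mem).2.symm.trans
    (SchurReduction.mem_cluster.1 h.right_mem).2

theorem isUpperSegment (hS : IsSchur π) (h3 : ∀ x ∈ π, 3 ≤ x) (h4 : 4 ∉ π)
    (h : IsMixedEnds π k o e) : IsUpperSegment π (between π o e) := by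
  have hseg := h.segment hS h3
  refine ⟨Finset.filter_subset _ _, hseg.upperMinimal, ?_⟩
  rintro x (hx | hx)
  · rw [hx.unique hseg.isLeast, ← paired_eq_of_notMem h4]
    exact h.left_notMem
  · rw [hx.unique hseg.isGreatest, ← paired_eq_of_notMem h4]
    exact h.right_notMem

/-- An upper minimal segment that meets a mixed cluster lies between its ends. -/
theorem subset_between (hS : IsSchur π) (h4 : 4 ∉ π) (h : IsMixedEnds π k o e) {T : Finset ℕ}
    (hT : IsUpperSegment π T) {x : ℕ} (hx : x ∈ T)
    (hxk : key x ∈ cluster (paired π) (keys π) k) : T ⊆ between π o e := by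
  obtain ⟨o', e', hseg, ho', he', hc⟩ := hT.exists_ends hS h4
  have hpar := hseg.odd_even
  have hxm := hseg.mem_ends.2.2 x hx
  have hko := key_of_odd hpar.1
  have hke := key_of_even hpar.2.1
  rw [hko, hke] at hc
  have h1 : o' ≤ key x := by
    have := le_key x
    have := odd_key (x := x) (by omega)
    grind
  have h2 : key x ≤ e' - 1 := by
    have := key_le x
    have := odd_key (x := x) (by omega)
    grind
  have hxc := (SchurReduction.mem_cluster.1 hxk).2
  have hox := hc.of_le h1 h2
  have hoc : o' ∈ cluster (paired π) (keys π) k := SchurReduction.mem_cluster.2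
    ⟨mem_keys.2 ⟨o', hT.1 hseg.mem_ends.1, ho', hko⟩, hxc.trans hox.symm⟩
  have hec : e' - 1 ∈ cluster (paired π) (keys π) k := SchurReduction.mem_cluster.2
    ⟨mem_keys.2 ⟨e', hT.1 hseg.mem_ends.2.1, he', hke⟩, hxc.trans (hox.symm.trans hc)⟩
  have h5 := h.le _ hoc
  have h6 := h.le _ hec
  have h7 := h.lt
  intro z hz
  have := hseg.mem_ends.2.2 z hz
  exact Finset.mem_filter.2 ⟨hT.1 hz, by omega, by omega⟩

theorem isLongestUpperSegment (hS : IsSchur π) (h3 : ∀ x ∈ π, 3 ≤ x) (h4 : 4 ∉ π)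
    (h : IsMixedEnds π k o e) : IsLongestUpperSegment π (between π o e) := by
  refine ⟨h.isUpperSegment hS h3 h4, fun T hT hss => ?_⟩
  refine hss.2 (h.subset_between hS h4 hT (hss.1 (h.segment hS h3).mem_ends.1) ?_)
  rw [key_of_odd h.odd]
  exact h.left_mem

/-- Restriction to the interval cuts no run of paired parts: by separation, a run crossing an end
would contain it, but the ends are singletons. Thus the segment, taken as a partition of its own,
has the same pairs as within `π`. -/
theorem isSigned (hS : IsSchur π) (h3 : ∀ x ∈ π, 3 ≤ x) (h : IsMixedEnds π k o e) :
    IsSigned (between (paired π) o e) (cluster (paired π) (keys π) k)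
      (cluster (paired π) (keys π) k ∩ evenKeys π) := by
  have hsig := isSigned_of_isSchur hS h3
  have hP : between (paired π) o e ⊆ paired π := Finset.filter_subset _ _
  have hC := cluster_subset (paired π) (keys π) k
  have hoK := hC h.left_mem
  have heK := hC h.right_mem
  have hlt := h.lt
  refine ⟨⟨fun q hq => hsig.five_le q (hP hq), ⟨fun x hx => hsig.schur.1 x (hP hx),
    fun x hx y hy => hsig.schur.2 x (hP hx) y (hP hy)⟩, fun q hq => hsig.not_dvd q (hP hq), ?_,
    fun j hj => hsig.key_odd j (hC hj), fun j hj => hsig.three_le j (hC hj),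
    fun i hi j hj => hsig.gap i (hC hi) j (hC hj),
    fun q hq j hj => hsig.sep q (hP hq) j (hC hj)⟩, Finset.inter_subset_left, ?_⟩
  · intro a l hr
    refine hsig.even_run a l ⟨hr.1, fun i hi => hP (hr.mem hi), fun b hb hba => ?_, fun hc => ?_⟩
    · have ha := hr.mem hr.1
      rw [mul_zero, add_zero] at ha
      have ha' := (Finset.mem_filter.1 ha).2
      have hb' : b < o := by
        by_contra hc
        exact hr.2.2.1 b (Finset.mem_filter.2 ⟨hb, by omega, by omega⟩) hba
      have := hsig.sep b hb o hoK
      exact h.left_notMem (by rw [show o = a by omega]; exact hP ha)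
    · have hl := hr.1
      have ha := hr.mem (i := l - 1) (by omega)
      have ha' := (Finset.mem_filter.1 ha).2
      have hb' : e < a + 3 * l := by
        by_contra hc'
        exact hr.2.2.2 (Finset.mem_filter.2 ⟨hc, by omega, by omega⟩)
      have := hsig.sep _ hc _ heK
      exact h.right_notMem (by rw [show e = a + 3 * (l - 1) by omega]; exact hP ha)
  · intro j hj i hi hl
    rw [Finset.mem_inter] at hj ⊢
    refine ⟨hi, hsig.mono j hj.2 i (hC hi) ?_⟩
    obtain ⟨hj3, p, hp, hpP, rfl⟩ := hl
    exact ⟨hj3, p, hp, fun n hn => hP (hpP n hn), rfl⟩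

theorem place_eq {C E : Finset ℕ} {i : ℕ} (hi : i ∈ C) : place (C ∩ E) i = place E i := by
  simp [place, hi]

theorem realize_eq (hS : IsSchur π) (h3 : ∀ x ∈ π, 3 ≤ x) (h : IsMixedEnds π k o e) :
    realize (between (paired π) o e) (cluster (paired π) (keys π) k)
      (cluster (paired π) (keys π) k ∩ evenKeys π) = between π o e := by
  have hsig := isSigned_of_isSchur hS h3
  have hodd := h.odd
  have heven := h.even
  have hlt := h.lt
  ext x
  rw [mem_realize, between, between, Finset.mem_filter, Finset.mem_filter]
  constructor
  · rintro (⟨hx, hx'⟩ | ⟨i, hi, rfl⟩)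
    · exact ⟨paired_subset π hx, hx'⟩
    · rw [place_eq hi]
      have h1 := h.le i hi
      have h2 := le_place (evenKeys π) i
      have h5 := place_le (evenKeys π) i
      refine ⟨?_, by omega, by omega⟩
      have := hsig.mem_realize_sdiff.2 ⟨i, cluster_subset _ _ _ hi, rfl⟩
      rw [realize_paired hS] at this
      exact this.1
  · rintro ⟨hx, h1, h2⟩
    by_cases hxP : x ∈ paired π
    · exact Or.inl ⟨hxP, h1, h2⟩
    · rw [← realize_paired hS] at hx
      obtain ⟨i, hi, rfl⟩ := hsig.mem_realize_sdiff.1 ⟨hx, hxP⟩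
      have h6 := hsig.key_odd i hi
      have h7 := le_place (evenKeys π) i
      have h8 := place_le (evenKeys π) i
      have hiC := h.mem_cluster hi (by grind) (by grind)
      exact Or.inr ⟨i, hiC, place_eq hiC⟩

end IsMixedEnds

open Classical in
/-- The part of the image, before all parts are lowered by `3`, that comes from the part `x`. -/
noncomputable def move (π : Finset ℕ) (x : ℕ) : ℕ :=
  if x ∈ paired π then x else place (flip (paired π) (keys π) (evenKeys π)) (key x)

/-- The ends of `S` lie in one cluster and have different parities. By maximality `S` is the whole
stretch spanned by that cluster, where `IsSigned.rhoPart_place` computes `ρ` as the flip. -/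
theorem rhoPart_eq (hS : IsSchur π) (h3 : ∀ x ∈ π, 3 ≤ x) (h4 : 4 ∉ π) {S : Finset ℕ}
    (hL : IsLongestUpperSegment π S) {x : ℕ} (hx : x ∈ S) : rhoPart S x = move π x - 3 := by
  have hsig := isSigned_of_isSchur hS h3
  obtain ⟨o, e, hseg, ho, he, hc⟩ := hL.1.exists_ends hS h4
  have hpar := hseg.odd_even
  have hoπ := hL.1.1 hseg.mem_ends.1
  have heπ := hL.1.1 hseg.mem_ends.2.1
  have hoK : key o ∈ keys π := mem_keys.2 ⟨o, hoπ, ho, rfl⟩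
  have hoE : key o ∉ evenKeys π := by
    intro hcon
    obtain ⟨y, hy, -, hye, hyo⟩ := mem_evenKeys.1 hcon
    rw [key_inj_of_isSchur hS hy hoπ hyo] at hye
    exact Nat.not_even_iff_odd.2 hpar.1 hye
  have heE : key e ∈ evenKeys π := mem_evenKeys.2 ⟨e, heπ, he, hpar.2.1, rfl⟩
  obtain ⟨o', e', hm⟩ := exists_isMixedEnds hS h3 (mem_cluster_self hoK) hoE
    (mem_cluster.2 ⟨hsig.subset heE, hc⟩) heE
  have hsub := hm.subset_between hS h4 hL.1 hseg.mem_ends.1 (mem_cluster_self hoK)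
  obtain rfl : S = between π o' e' := by
    by_contra hne
    exact hL.2 _ (hm.isUpperSegment hS h3 h4) (Finset.ssubset_iff_subset_ne.2 ⟨hsub, hne⟩)
  have hsig' := hm.isSigned hS h3
  have h4' : 4 ∉ between π o' e' := fun hcon => h4 (Finset.mem_filter.1 hcon).1
  rw [← hm.realize_eq hS h3] at h4' hx ⊢
  by_cases hxP : x ∈ between (paired π) o' e'
  · rw [hsig'.rhoPart_of_mem h4' hxP, move, if_pos (Finset.mem_filter.1 hxP).1]
  · obtain ⟨i, hi, rfl⟩ := hsig'.mem_realize_sdiff.1 ⟨hx, hxP⟩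
    rw [hsig'.rhoPart_place h4' _ hi]
    · have hiK := cluster_subset _ _ _ hi
      have hodd := hsig.key_odd i hiK
      rw [IsMixedEnds.place_eq hi, move, if_neg (hsig.place_notMem hiK _), key_place hodd, place]
      have hcl := cluster_eq (mem_cluster.1 hi).2
      simp only [mem_flip, hiK, true_and, hcl]
    · intro a ha b hb hab
      rw [Finset.mem_inter] at ha ⊢
      exact ⟨hb, hsig.mem_of_sameCluster ha.2 (cluster_subset _ _ _ hb) hab
        ((mem_cluster.1 ha.1).2.symm.trans (mem_cluster.1 hb).2)⟩

theorem freeReduce_eq (hS : IsSchur π) (h3 : ∀ x ∈ π, 3 ≤ x) (h4 : 4 ∉ π) {x : ℕ} (hx : x ∈ π)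
    (hfree : ∀ S, IsLongestUpperSegment π S → x ∉ S) : freeReduce π x = move π x - 3 := by
  have hsig := isSigned_of_isSchur hS h3
  rw [freeReduce, move]
  by_cases hxP : x ∈ paired π
  · rw [if_pos hxP, if_pos ((paired_eq_of_notMem h4).1 hxP)]
  rw [if_neg hxP, if_neg (fun hc => hxP ((paired_eq_of_notMem h4).2 hc))]
  have hkK : key x ∈ keys π := mem_keys.2 ⟨x, hx, hxP, rfl⟩
  have hself := mem_cluster_self (P := paired π) hkK
  -- The cluster of a free singleton has a single sign; otherwise `x` would lie in the segment it
  -- spans. The flip then reverses every sign in it.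
  have hnot : ∀ i ∈ cluster (paired π) (keys π) (key x), i ∉ evenKeys π →
      ∀ j ∈ cluster (paired π) (keys π) (key x), j ∉ evenKeys π := by
    intro i hi hiE j hj hjE
    obtain ⟨o, e, hm⟩ := exists_isMixedEnds hS h3 hi hiE hj hjE
    refine hfree _ (hm.isLongestUpperSegment hS h3 h4) (Finset.mem_filter.2 ⟨hx, ?_⟩)
    have h1 := hm.le _ hself
    have h2 := le_key x
    have h5 := key_le x
    have h6 := hm.lt
    omega
  have h3x := h3 x hx
  rcases Nat.even_or_odd x with hpar | hpar
  · have hE : key x ∈ evenKeys π := mem_evenKeys.2 ⟨x, hx, hxP, hpar, rfl⟩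
    have hall : cluster (paired π) (keys π) (key x) ∩ evenKeys π =
        cluster (paired π) (keys π) (key x) := by
      rw [Finset.inter_eq_left]
      intro i hi
      by_contra hiE
      exact hnot i hi hiE _ hself hE
    rw [if_pos hpar, place_of_notMem, key_of_even hpar]
    · omega
    · rw [mem_flip, hall]
      rintro ⟨-, hle⟩
      refine absurd hle (not_le.2 (Finset.card_lt_card ?_))
      rw [Finset.ssubset_iff_of_subset (Finset.filter_subset _ _)]
      exact ⟨key x, hself, by simp⟩
  · have hE : key x ∉ evenKeys π := by
      intro hc
      obtain ⟨y, hy, -, hye, e⟩ := mem_evenKeys.1 hc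
      rw [key_inj_of_isSchur hS hy hx e] at hye
      exact Nat.not_even_iff_odd.2 hpar hye
    have hall : cluster (paired π) (keys π) (key x) ∩ evenKeys π = ∅ := by
      rw [← Finset.not_nonempty_iff_eq_empty]
      rintro ⟨j, hj⟩
      rw [Finset.mem_inter] at hj
      exact hnot _ hself hE j hj.1 hj.2
    rw [if_neg (Nat.not_even_iff_odd.2 hpar), place_of_mem, key_of_odd hpar]
    · omega
    · rw [mem_flip, hall]
      exact ⟨hkK, by simp⟩

/-- The image under the exchange of signs. -/
noncomputable def exchange (π : Finset ℕ) : Finset ℕ :=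
  realize (paired π) (keys π) (flip (paired π) (keys π) (evenKeys π))

theorem exchange_eq_image (π : Finset ℕ) : exchange π = π.image (move π) := by
  ext y
  rw [exchange, mem_realize, Finset.mem_image]
  constructor
  · rintro (hy | ⟨k, hk, rfl⟩)
    · exact ⟨y, paired_subset π hy, if_pos hy⟩
    · obtain ⟨x, hx, hx', rfl⟩ := mem_keys.1 hk
      exact ⟨x, hx, if_neg hx'⟩
  · rintro ⟨x, hx, rfl⟩
    by_cases hx' : x ∈ paired π
    · rw [move, if_pos hx']
      exact Or.inl hx'
    · rw [move, if_neg hx']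
      exact Or.inr ⟨key x, mem_keys.2 ⟨x, hx, hx', rfl⟩, rfl⟩

theorem psi_eq (hS : IsSchur π) (h3 : ∀ x ∈ π, 3 ≤ x) (h4 : 4 ∉ π) :
    psi π = (exchange π).image (· - 3) := by
  rw [exchange_eq_image, Finset.image_image]
  ext y
  simp only [psi, Finset.mem_union, Finset.mem_biUnion, Finset.mem_image, rho, freeParts,
    longestSegments, Finset.mem_sdiff, Finset.mem_filter, Finset.mem_powerset, id,
    Function.comp_apply, not_exists, not_and]
  constructor
  · rintro (⟨S, ⟨hSπ, hL⟩, x, hx, rfl⟩ | ⟨x, ⟨hx, hfree⟩, rfl⟩)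
    · exact ⟨x, hSπ hx, (rhoPart_eq hS h3 h4 hL hx).symm⟩
    · exact ⟨x, hx, (freeReduce_eq hS h3 h4 hx fun S hL => hfree S ⟨hL.1.1, hL⟩).symm⟩
  · rintro ⟨x, hx, rfl⟩
    by_cases hfree : ∃ S, IsLongestUpperSegment π S ∧ x ∈ S
    · obtain ⟨S, hL, hxS⟩ := hfree
      exact Or.inl ⟨S, ⟨hL.1.1, hL⟩, x, hxS, rhoPart_eq hS h3 h4 hL hxS⟩
    · push Not at hfree
      exact Or.inr ⟨x, ⟨hx, fun S hL => hfree S hL.2⟩, freeReduce_eq hS h3 h4 hx hfree⟩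

end Cluster

/-! ### The exchange of signs as an involution -/

theorem isSchur_exchange {π : Finset ℕ} (hS : IsSchur π) (h3 : ∀ x ∈ π, 3 ≤ x) :
    IsSchur (exchange π) :=
  (isSigned_of_isSchur hS h3).flip.isSchur

theorem three_le_exchange {π : Finset ℕ} (hS : IsSchur π) (h3 : ∀ x ∈ π, 3 ≤ x) :
    ∀ x ∈ exchange π, 3 ≤ x := fun _ hx => (isSigned_of_isSchur hS h3).flip.three_le_of_mem hx

theorem exchange_exchange {π : Finset ℕ} (hS : IsSchur π) (h3 : ∀ x ∈ π, 3 ≤ x) :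
    exchange (exchange π) = π := by
  have h := isSigned_of_isSchur hS h3
  have h' := h.flip
  rw [exchange, exchange, h'.paired_realize, h'.keys_realize, h'.evenKeys_realize, h.flip_flip,
    realize_paired hS]

theorem IsSigned.four_mem_iff {P K E : Finset ℕ} (h : IsSigned P K E) :
    4 ∈ realize P K E ↔ 3 ∈ E := by
  rw [mem_realize]
  constructor
  · rintro (hP | ⟨k, hk, e⟩)
    · have := h.five_le 4 hP; omega
    · have hkE := (even_place (E := E) (h.key_odd k hk)).1 (by rw [e]; decide)
      rw [place_of_mem hkE] at e
      obtain rfl : k = 3 := by omega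
      exact hkE
  · exact fun hE => Or.inr ⟨3, h.subset hE, place_of_mem hE⟩

theorem IsSigned.three_mem_iff {P K E : Finset ℕ} (h : IsSigned P K E) :
    3 ∈ realize P K E ↔ 3 ∈ K ∧ 3 ∉ E := by
  rw [mem_realize]
  constructor
  · rintro (hP | ⟨k, hk, e⟩)
    · have := h.five_le 3 hP; omega
    · have hkE : k ∉ E := fun hkE => by
        have := (even_place (E := E) (h.key_odd k hk)).2 hkE
        rw [e] at this
        revert this
        decide
      rw [place_of_notMem hkE] at e
      exact e ▸ ⟨hk, hkE⟩
  · exact fun hE => Or.inr ⟨3, hE.1, place_of_notMem hE.2⟩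

/-- Links start above 3 and 3 is the least possible key, so it forms a cluster by itself and its
sign is reversed. -/
theorem IsConfig.three_mem_flip_iff {P K E : Finset ℕ} (h : IsConfig P K) :
    3 ∈ flip P K E ↔ 3 ∈ K ∧ 3 ∉ E := by
  rw [mem_flip]
  refine and_congr_right fun h3 => ?_
  have hcl : cluster P K 3 = {3} := by
    ext j
    rw [mem_cluster, Finset.mem_singleton]
    constructor
    · rintro ⟨hj, hc⟩
      by_contra hne
      have := h.three_le j hj
      obtain ⟨k, -, hl⟩ := hc 3 h3 (by omega) (by omega)
      exact absurd hl.1 (lt_irrefl 3)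
    · rintro rfl
      exact ⟨h3, SameCluster.refl P K 3⟩
  rw [hcl]
  by_cases hE : 3 ∈ E <;> simp [hE, Finset.filter_singleton]

theorem three_mem_exchange_iff {π : Finset ℕ} (hS : IsSchur π) (h3 : ∀ x ∈ π, 3 ≤ x) :
    3 ∈ exchange π ↔ 4 ∈ π := by
  have h := isSigned_of_isSchur hS h3
  conv_rhs => rw [← realize_paired hS]
  rw [exchange, h.flip.three_mem_iff, h.four_mem_iff, h.three_mem_flip_iff]
  have := @h.subset 3
  tauto

theorem isStar_iff {π : Finset ℕ} :
    IsStar π ↔ (∀ x ∈ π, 3 ≤ x) ∧ 4 ∉ π := by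
  constructor
  · intro h
    refine ⟨fun x hx => ?_, fun h4 => ?_⟩
    · rcases Nat.even_or_odd x with hp | hp
      · have := (h x hx).2 hp; omega
      · exact (h x hx).1 hp
    · have := (h 4 h4).2 (by decide)
      omega
  · rintro ⟨h3, h4⟩ x hx
    refine ⟨fun _ => h3 x hx, fun he => ?_⟩
    have := h3 x hx
    have : x ≠ 4 := fun e => h4 (e ▸ hx)
    grind

/-! ### The shift by 3 and the bijection -/

theorem isSchur_image_sub {T : Finset ℕ} (hT : IsSchur T) (h4 : ∀ x ∈ T, 4 ≤ x) :
    IsSchur (T.image (· - 3)) := by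
  constructor
  · intro x hx
    obtain ⟨t, ht, rfl⟩ := Finset.mem_image.1 hx
    have := h4 t ht
    omega
  · intro x hx y hy hxy
    obtain ⟨t, ht, rfl⟩ := Finset.mem_image.1 hx
    obtain ⟨u, hu, rfl⟩ := Finset.mem_image.1 hy
    have h1 := h4 t ht
    have h2 := h4 u hu
    have := hT.2 t ht u hu (by omega)
    omega

theorem isSchur_image_add {τ : Finset ℕ} (hT : IsSchur τ) : IsSchur (τ.image (· + 3)) := by
  constructor
  · intro x hx
    obtain ⟨t, ht, rfl⟩ := Finset.mem_image.1 hx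
    omega
  · intro x hx y hy hxy
    obtain ⟨t, ht, rfl⟩ := Finset.mem_image.1 hx
    obtain ⟨u, hu, rfl⟩ := Finset.mem_image.1 hy
    have := hT.2 t ht u hu (by omega)
    omega

theorem image_sub_image_add (τ : Finset ℕ) : (τ.image (· + 3)).image (· - 3) = τ := by
  simp [Finset.image_image, Function.comp_def]

theorem image_add_image_sub {T : Finset ℕ} (h : ∀ x ∈ T, 3 ≤ x) :
    (T.image (· - 3)).image (· + 3) = T := by
  rw [Finset.image_image]
  refine (Finset.image_congr fun x hx => ?_).trans Finset.image_id
  have := h x hx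
  simp only [Function.comp_apply, id]
  omega

theorem four_le_exchange {π : Finset ℕ} (hS : IsSchur π) (h3 : ∀ x ∈ π, 3 ≤ x) (h4 : 4 ∉ π) :
    ∀ x ∈ exchange π, 4 ≤ x := by
  intro x hx
  have h1 := three_le_exchange hS h3 x hx
  rcases Nat.eq_or_lt_of_le h1 with rfl | h
  · exact absurd ((three_mem_exchange_iff hS h3).1 hx) h4
  · exact h

/-- The Schur reduction map is a bijection onto all Schur partitions. -/
theorem bijOn_psi : Set.BijOn psi {π | IsSchur π ∧ IsStar π} {τ | IsSchur τ} := by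
  have hinv : ∀ τ, IsSchur τ → IsSchur (exchange (τ.image (· + 3))) ∧
      (∀ x ∈ exchange (τ.image (· + 3)), 3 ≤ x) ∧ 4 ∉ exchange (τ.image (· + 3)) := by
    intro τ hτ
    have h1 := isSchur_image_add hτ
    have h2 : ∀ x ∈ τ.image (· + 3), 3 ≤ x := by
      intro x hx
      obtain ⟨t, ht, rfl⟩ := Finset.mem_image.1 hx
      omega
    refine ⟨isSchur_exchange h1 h2, three_le_exchange h1 h2, ?_⟩
    -- A part 4 here would come from a part 3 of the shifted partition, that is, from a part 0 of
    -- `τ`.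
    rw [← three_mem_exchange_iff (isSchur_exchange h1 h2) (three_le_exchange h1 h2),
      exchange_exchange h1 h2, Finset.mem_image]
    rintro ⟨t, ht, e⟩
    have := hτ.1 t ht
    omega
  refine Set.InvOn.bijOn (f' := fun τ => exchange (τ.image (· + 3))) ⟨?_, ?_⟩ ?_ ?_
  · rintro π ⟨hS, hstar⟩
    obtain ⟨h3, h4⟩ := isStar_iff.1 hstar
    dsimp only
    rw [psi_eq hS h3 h4, image_add_image_sub (three_le_exchange hS h3), exchange_exchange hS h3]
  · intro τ hτ
    obtain ⟨h1, h2, h4⟩ := hinv τ hτ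
    dsimp only
    rw [psi_eq h1 h2 h4, exchange_exchange (isSchur_image_add hτ), image_sub_image_add]
    intro x hx
    obtain ⟨t, ht, rfl⟩ := Finset.mem_image.1 hx
    omega
  · rintro π ⟨hS, hstar⟩
    obtain ⟨h3, h4⟩ := isStar_iff.1 hstar
    rw [psi_eq hS h3 h4]
    exact isSchur_image_sub (isSchur_exchange hS h3) (four_le_exchange hS h3 h4)
  · intro τ hτ
    obtain ⟨h1, h2, h4⟩ := hinv τ hτ
    exact ⟨h1, isStar_iff.2 ⟨h2, h4⟩⟩

/-! ### Statistics -/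

namespace IsSigned

variable {P K E : Finset ℕ}

theorem place_injOn (h : IsSigned P K E) : Set.InjOn (place E) K := by
  intro j hj k hk e
  rw [← key_place (E := E) (h.key_odd j hj), e, key_place (h.key_odd k hk)]

theorem disjoint_place (h : IsSigned P K E) : Disjoint P (K.image (place E)) := by
  rw [Finset.disjoint_left]
  intro x hx hx'
  obtain ⟨k, hk, rfl⟩ := Finset.mem_image.1 hx'
  exact h.place_notMem hk E hx

theorem sum_realize (h : IsSigned P K E) (f : ℕ → ℕ) :
    ∑ x ∈ realize P K E, f x = ∑ x ∈ P, f x + ∑ k ∈ K, f (place E k) := by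
  rw [realize, Finset.sum_union h.disjoint_place, Finset.sum_image h.place_injOn]

theorem card_realize (h : IsSigned P K E) : (realize P K E).card = P.card + K.card := by
  rw [realize, Finset.card_union_of_disjoint h.disjoint_place,
    Finset.card_image_of_injOn h.place_injOn]

theorem sum_ite_mem (h : IsSigned P K E) : ∑ k ∈ K, (if k ∈ E then 1 else 0) = E.card := by
  rw [← Finset.card_filter, Finset.filter_mem_eq_inter, Finset.inter_eq_right.2 h.subset]

theorem size_realize (h : IsSigned P K E) :
    size (realize P K E) = size P + size K + E.card := by
  rw [size, h.sum_realize fun x => x, size, size, add_assoc, ← h.sum_ite_mem,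
    ← Finset.sum_add_distrib]
  congr 1
  refine Finset.sum_congr rfl fun k _ => ?_
  unfold place
  split_ifs <;> rfl

theorem numEven_realize (h : IsSigned P K E) :
    numEven (realize P K E) = numEven P + E.card := by
  rw [numEven, Finset.card_filter, h.sum_realize, numEven, Finset.card_filter, ← h.sum_ite_mem]
  congr 1
  refine Finset.sum_congr rfl fun k hk => ?_
  simp only [even_place (h.key_odd k hk)]

end IsSigned

theorem numOdd_add_numEven (A : Finset ℕ) : numOdd A + numEven A = A.card := by
  have := Finset.card_filter_add_card_filter_not (s := A) fun x => Odd x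
  simpa only [Nat.not_odd_iff_even, numOdd, numEven] using this

theorem sub_injOn {T : Finset ℕ} (h : ∀ x ∈ T, 3 ≤ x) : Set.InjOn (· - 3) (T : Set ℕ) := by
  intro x hx y hy e
  have := h x hx
  have := h y hy
  dsimp only at e
  omega

theorem numOdd_image_sub {T : Finset ℕ} (h : ∀ x ∈ T, 3 ≤ x) :
    numOdd (T.image (· - 3)) = numEven T := by
  rw [numOdd, numEven, Finset.card_filter, Finset.card_filter, Finset.sum_image (sub_injOn h)]
  refine Finset.sum_congr rfl fun x hx => ?_
  have : Odd (x - 3) ↔ Even x := by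
    have := h x hx
    grind
  simp only [this]

theorem card_image_sub {T : Finset ℕ} (h : ∀ x ∈ T, 3 ≤ x) : (T.image (· - 3)).card = T.card :=
  Finset.card_image_of_injOn (sub_injOn h)

theorem size_image_sub {T : Finset ℕ} (h : ∀ x ∈ T, 3 ≤ x) :
    size (T.image (· - 3)) + 3 * T.card = size T := by
  rw [size, Finset.sum_image (sub_injOn h), mul_comm, ← smul_eq_mul, ← Finset.sum_const,
    ← Finset.sum_add_distrib]
  exact Finset.sum_congr rfl fun x hx => Nat.sub_add_cancel (h x hx)

/-- The shift reverses parities, which interchanges the exceptions for upper and lower pairs, and it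
turns the erased part 4 into the part 1 outside the runs. -/
theorem lowerPaired_image_sub_iff {T : Finset ℕ} (h4 : ∀ x ∈ T, 4 ≤ x) {x : ℕ} :
    LowerPaired (T.image (· - 3)) x ↔ UpperPaired (T.erase 4) (x + 3) := by
  have hτ : ∀ y, 0 < y → (y ∈ T.image (· - 3) ↔ y + 3 ∈ T) := by
    intro y hy
    rw [Finset.mem_image]
    constructor
    · rintro ⟨t, ht, rfl⟩
      rwa [Nat.sub_add_cancel (by omega)]
    · exact fun h => ⟨_, h, by omega⟩
  have hB : ∀ y, y ∈ (T.image (· - 3)).filter (1 < ·) ↔ y + 3 ∈ T.erase 4 := by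
    intro y
    rw [Finset.mem_filter, Finset.mem_erase]
    constructor
    · rintro ⟨h1, h2⟩
      exact ⟨by omega, (hτ y (by omega)).1 h1⟩
    · rintro ⟨h1, h2⟩
      have := h4 _ h2
      exact ⟨(hτ y (by omega)).2 h2, by omega⟩
  have hrun : ∀ a l, IsMaxRun ((T.image (· - 3)).filter (1 < ·)) a l ↔
      IsMaxRun (T.erase 4) (a + 3) l := by
    intro a l
    refine and_congr_right fun _ => and_congr ?_ (and_congr ?_ ?_)
    · refine forall₂_congr fun i _ => ?_
      rw [hB, show a + 3 * i + 3 = a + 3 + 3 * i by ring]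
    · constructor
      · intro h b hb e
        have h5 : 3 ≤ b := by
          have := h4 b (Finset.mem_of_mem_erase hb); omega
        exact h (b - 3) ((hB _).2 (by rwa [Nat.sub_add_cancel h5])) (by omega)
      · intro h b hb e
        exact h (b + 3) ((hB b).1 hb) (by omega)
    · rw [hB, show a + 3 * l + 3 = a + 3 + 3 * l by ring]
  have hmin : IsOddRunMin ((T.image (· - 3)).filter (1 < ·)) x ↔
      IsOddRunMin (T.erase 4) (x + 3) := by
    simp only [IsOddRunMin, hrun]
  have hmax : IsOddRunMax ((T.image (· - 3)).filter (1 < ·)) x ↔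
      IsOddRunMax (T.erase 4) (x + 3) := by
    constructor
    · rintro ⟨a, l, hl, hr, e⟩
      exact ⟨a + 3, l, hl, (hrun a l).1 hr, by omega⟩
    · rintro ⟨a, l, hl, hr, e⟩
      have ha := h4 _ (Finset.mem_of_mem_erase (hr.mem hr.1))
      rw [mul_zero, add_zero] at ha
      obtain ⟨b, rfl⟩ : ∃ b, a = b + 3 := ⟨a - 3, by omega⟩
      exact ⟨b, l, hl, (hrun b l).2 hr, by omega⟩
  have hodd : Odd (x + 3) ↔ Even x := by grind
  have heven : Even (x + 3) ↔ Odd x := by grind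
  rw [LowerPaired, UpperPaired, hmin, hmax, hodd, heven]
  constructor
  · rintro ⟨h1, h2, h3, h5, h6⟩
    have hmem : x + 3 ∈ T.erase 4 := (hB x).1 (Finset.mem_filter.2 ⟨h1, h2⟩)
    refine ⟨hmem, ?_, h5, h6⟩
    by_cases hnext : x + 3 + 3 ∈ T.erase 4
    · exact Or.inl hnext
    right
    rcases h3 with h3 | ⟨y, hy, rfl⟩
    · exact absurd ((hB _).1 (Finset.mem_filter.2 ⟨h3, by omega⟩)) hnext
    · refine ⟨y + 3, ?_, rfl⟩
      by_contra hpred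
      -- The part 1 counts as a neighbour in `LowerPaired` but belongs to no run. If it is the only
      -- neighbour of 4, then 4 is a run of length 1 and, being even, is excluded as its largest
      -- member.
      have hy1 : y = 1 := by
        by_contra hne
        have hy0 : 0 < y := by
          obtain ⟨t, ht, rfl⟩ := Finset.mem_image.1 hy
          have := h4 t ht
          omega
        exact hpred ((hB y).1 (Finset.mem_filter.2 ⟨hy, by omega⟩))
      subst hy1
      refine h5 ⟨by decide, 7, 1, odd_one, ⟨one_pos, fun i hi => ?_, fun b hb e => ?_, hnext⟩, rfl⟩
      · obtain rfl : i = 0 := by omega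
        exact hmem
      · exact (Finset.mem_erase.1 hb).1 (by omega)
  · rintro ⟨h1, h3, h5, h6⟩
    have hx := Finset.mem_filter.1 ((hB x).2 h1)
    refine ⟨hx.1, hx.2, ?_, h5, h6⟩
    rcases h3 with h3 | ⟨y, hy, e⟩
    · exact Or.inl (Finset.mem_filter.1 ((hB (x + 3)).2 h3)).1
    · have := h4 y (Finset.mem_of_mem_erase hy)
      refine Or.inr ⟨y - 3, (Finset.mem_filter.1 ((hB (y - 3)).2 ?_)).1, by omega⟩
      rwa [Nat.sub_add_cancel (by omega)]

theorem numUpperPaired_eq {π : Finset ℕ} (h4 : 4 ∉ π) (r : ℕ) :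
    numUpperPaired r π = ((paired π).filter (· ≡ r [MOD 3])).card := by
  rw [numUpperPaired]
  congr 1
  ext x
  simp only [Finset.mem_filter, ← paired_eq_of_notMem h4]
  have := @paired_subset π x
  tauto

theorem numLowerPaired_image_sub {T : Finset ℕ} (h4 : ∀ x ∈ T, 4 ≤ x) (r : ℕ) :
    numLowerPaired r (T.image (· - 3)) = ((paired T).filter (· ≡ r [MOD 3])).card := by
  rw [numLowerPaired]
  refine (Finset.card_bij' (fun x _ => x + 3) (fun x _ => x - 3) ?_ ?_ ?_ ?_)
  · intro x hx
    simp only [Finset.mem_filter] at hx ⊢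
    refine ⟨mem_paired.2 ((lowerPaired_image_sub_iff h4).1 hx.2.1), ?_⟩
    simpa [Nat.ModEq] using hx.2.2
  · intro x hx
    rw [Finset.mem_filter] at hx
    have hxT := paired_subset T hx.1
    have h5 := h4 x hxT
    simp only [Finset.mem_filter]
    refine ⟨Finset.mem_image_of_mem _ hxT, (lowerPaired_image_sub_iff h4).2 ?_, ?_⟩
    · rw [Nat.sub_add_cancel (by omega)]
      exact mem_paired.1 hx.1
    · have := hx.2
      unfold Nat.ModEq at this ⊢
      omega
  · intro x _
    simp
  · intro x hx
    have := h4 x (paired_subset T (Finset.mem_filter.1 hx).1)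
    exact Nat.sub_add_cancel (by omega)

/-- The effect of the Schur reduction map on the statistics. -/
theorem psi_stats {π : Finset ℕ} (hS : IsSchur π) (hstar : IsStar π) :
    numOdd (psi π) = numOdd π ∧ numEven (psi π) = numEven π ∧
      size (psi π) + 2 * (numOdd π + 2 * numEven π) = size π ∧
      ∀ r, numLowerPaired r (psi π) = numUpperPaired r π := by
  obtain ⟨h3, h4⟩ := isStar_iff.1 hstar
  have h := isSigned_of_isSchur hS h3
  have h' := h.flip
  have hT3 := three_le_exchange hS h3
  have hT4 := four_le_exchange hS h3 h4
  have hpar : numOdd (paired π) = numEven (paired π) := card_odd_eq_card_even h.even_run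
  have hP := numOdd_add_numEven (paired π)
  have hflip := card_flip (P := paired π) h.subset
  have e1 := h.numEven_realize
  have e2 := h.card_realize
  have e3 := h.size_realize
  rw [realize_paired hS] at e1 e2 e3
  have e4 : numEven (exchange π) = _ := h'.numEven_realize
  have e5 : (exchange π).card = _ := h'.card_realize
  have e6 : size (exchange π) = _ := h'.size_realize
  have e7 := numOdd_image_sub hT3
  have e8 := size_image_sub hT3
  have e9 := numOdd_add_numEven ((exchange π).image (· - 3))
  rw [card_image_sub hT3] at e9
  have e10 := numOdd_add_numEven π
  rw [psi_eq hS h3 h4]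
  -- Here `ω = |P|/2 + |K| - |E|` and `ε = |P|/2 + |E|`. The size changes by `|K| - 2|E|` under the
  -- flip and drops by `3(|P| + |K|)` under the shift, a total loss of `3|P| + 2|K| + 2|E| = 2(ω +
  -- 2ε)`.
  refine ⟨by omega, by omega, by omega, fun r => ?_⟩
  rw [numLowerPaired_image_sub hT4, numUpperPaired_eq h4, exchange, h'.paired_realize]

theorem bijOn_of_iff {α β : Type*} {f : α → β} {s : Set α} {t : Set β} (h : Set.BijOn f s t)
    {p : α → Prop} {q : β → Prop} (hpq : ∀ x ∈ s, p x ↔ q (f x)) :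
    Set.BijOn f {x | x ∈ s ∧ p x} {y | y ∈ t ∧ q y} := by
  refine ⟨fun x hx => ⟨h.mapsTo hx.1, (hpq x hx.1).1 hx.2⟩,
    h.injOn.mono fun x hx => hx.1, fun y hy => ?_⟩
  obtain ⟨x, hx, rfl⟩ := h.surjOn hy.1
  exact ⟨x, ⟨hx, (hpq x hx).2 hy.2⟩, rfl⟩

end SchurReduction

/-! ### Restriction of the bijection to prescribed statistics -/

theorem theorem3 :
    (∀ (ω ε p₁ p₂ : ℕ) (n : ℤ),
      Set.BijOn SchurReduction.psi (SchurReduction.refinedDStar ω ε p₁ p₂ n)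
        (SchurReduction.refinedD ω ε p₁ p₂ (n - 2 * ((ω : ℤ) + 2 * (ε : ℤ))))) ∧
    (∀ (m : ℕ) (n : ℤ),
      Set.BijOn SchurReduction.psi (SchurReduction.DStar m n)
        (SchurReduction.D m (n - 2 * (m : ℤ)))) := by
  open SchurReduction in
  constructor
  · intro ω ε p₁ p₂ n
    have := bijOn_of_iff bijOn_psi
      (p := fun π => (size π : ℤ) = n ∧ numOdd π = ω ∧ numEven π = ε ∧
        numUpperPaired 1 π = p₁ ∧ numUpperPaired 2 π = p₂)
      (q := fun τ => (size τ : ℤ) = n - 2 * ((ω : ℤ) + 2 * (ε : ℤ)) ∧ numOdd τ = ω ∧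
        numEven τ = ε ∧ numLowerPaired 1 τ = p₁ ∧ numLowerPaired 2 τ = p₂) (by
        rintro π ⟨hS, hstar⟩
        obtain ⟨h1, h2, h3, h4⟩ := psi_stats hS hstar
        simp only [h1, h2, h4]
        constructor
        · rintro ⟨h5, h6, h7, h8⟩
          exact ⟨by omega, h6, h7, h8⟩
        · rintro ⟨h5, h6, h7, h8⟩
          exact ⟨by omega, h6, h7, h8⟩)
    convert this using 1 <;> ext π <;> simp [refinedDStar, refinedD, and_assoc]
  · intro m n
    have := bijOn_of_iff bijOn_psi
      (p := fun π => (size π : ℤ) = n ∧ weight π = m)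
      (q := fun τ => (size τ : ℤ) = n - 2 * (m : ℤ) ∧ weight τ = m) (by
        rintro π ⟨hS, hstar⟩
        obtain ⟨h1, h2, h3, -⟩ := psi_stats hS hstar
        -- The weight is `ω + 2ε`, so the loss of size is twice the weight.
        have h4 := numOdd_add_numEven π
        have h5 := numOdd_add_numEven (psi π)
        simp only [weight]
        omega)
    convert this using 1 <;> ext π <;> simp [DStar, D, and_assoc]
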